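/- Let $Q_n=Q_n(x,y,z,t)$ $(n\ge 1)$ be the polynomials defined by $$Q_1=1,\qquad Q_{n+1}=\bigl[x+nz+(y+t)(n+y\,\partial_y)\bigr]Q_n ,$$ and let $Q_{n,k}(x,t)$ be the coefficient of $y^k$ in $Q_n(x,y,1,t)$. A plane tree on $[n]=\{1,\dots,n\}$ is a rooted tree with vertex set $[n]$ (the root may be any vertex) in which the children of each vertex are linearly ordered from left to right. For a vertex $i$ of a plane tree $T$, let $\beta_T(i)$ be the smallest descendant of $i$, where every vertex is a descendant of itself. A vertex $j$ is called elder if some brother $k$ of $j$ (a child of the same vertex) lying to the right of $j$ satisfies $\beta_T(k)<\beta_T(j)$; otherwise $j$ is younger. Let $\mathrm{eld}(T)$ be the number of elder vertices of $T$, and let $\mathrm{young}_T(v)$ be the number of younger children of the vertex $v$. An edge $(i,j)$, with $j$ a child of $i$, is proper if $j$ is elder or $i<\beta_T(j)$, and improper otherwise. Let $\mathcal P_{n,k}$ be the set of plane trees on $[n]$ with exactly $k$ improper edges. Theorem 2.2. For all integers $n\ge 1$ and $k\ge 0$, $$Q_{n,k}(x-t-1,t)=\sum_{T\in\mathcal P_{n,k}}x^{\mathrm{young}_T(1)}\,t^{\mathrm{eld}(T)}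 .$$ -/

import Mathlib

/-- The polynomials `Q n = Q_n(x, y, z, t)` with integer coefficients, where the variables
`X 0, X 1, X 2, X 3` are `x, y, z, t`:
`Q_1 = 1` and `Q_{n+1} = [x + n z + (y + t)(n + y ∂_y)] Q_n` for `n ≥ 1`.
The value at `n = 0` is a placeholder. -/
noncomputable def chapotonQ : ℕ → MvPolynomial (Fin 4) ℤ
  | 0 => 0
  | 1 => 1
  | n + 2 =>
      (MvPolynomial.X 0 + ((n + 1 : ℕ) : MvPolynomial (Fin 4) ℤ) * MvPolynomial.X 2)
          * chapotonQ (n + 1)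
        + (MvPolynomial.X 1 + MvPolynomial.X 3)
          * (((n + 1 : ℕ) : MvPolynomial (Fin 4) ℤ) * chapotonQ (n + 1)
            + MvPolynomial.X 1 * MvPolynomial.pderiv 1 (chapotonQ (n + 1)))

/-- `Q_n(x, y, 1, t)` as a polynomial in `y` over `ℤ[x, t]`
(in `ℤ[x, t]` the variables `X 0, X 1` are `x, t`). -/
noncomputable def chapotonQY (n : ℕ) : Polynomial (MvPolynomial (Fin 2) ℤ) :=
  MvPolynomial.aeval
    ![Polynomial.C (MvPolynomial.X 0), Polynomial.X, 1, Polynomial.C (MvPolynomial.X 1)]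
    (chapotonQ n)

/-- `Q_{n,k}(x, t)`: the coefficient of `y ^ k` in `Q_n(x, y, 1, t)`. -/
noncomputable def chapotonQCoeff (n k : ℕ) : MvPolynomial (Fin 2) ℤ :=
  (chapotonQY n).coeff k

/-- A (labeled, rooted) plane tree with vertex set `V`: a root together with, for every vertex,
the list of its children from left to right. -/
@[ext]
structure PlaneTree (V : Type*) where
  /-- the root -/
  root : V
  /-- the children of a vertex, from left to right -/
  children : V → List V
  /-- no vertex is listed twice among the children of a vertex -/
  nodup_children : ∀ v, (children v).Nodup
  /-- a vertex is the child of at most one vertex -/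
  parent_unique : ∀ i i' j, j ∈ children i → j ∈ children i' → i = i'
  /-- the root is not the child of any vertex -/
  root_not_child : ∀ i, root ∉ children i
  /-- every vertex can be reached from the root -/
  reachable : ∀ v, Relation.ReflTransGen (fun i j => j ∈ children i) root v

namespace PlaneTree

instance instFinite (V : Type*) [Finite V] : Finite (PlaneTree V) := by
  classical
  have := Fintype.ofFinite V
  let f : PlaneTree V → V × (V → {l : List V // l.Nodup}) :=
    fun T => (T.root, fun v => ⟨T.children v, T.nodup_children v⟩)
  refine Finite.of_injective f ?_
  intro S T h
  have h1 : S.root = T.root := congrArg Prod.fst h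
  have h2 := congrArg Prod.snd h
  refine PlaneTree.ext h1 ?_
  funext v
  exact congrArg Subtype.val (congrFun h2 v)

noncomputable instance instFintype (V : Type*) [Finite V] : Fintype (PlaneTree V) :=
  Fintype.ofFinite _

section Statistics

variable {V : Type*} [Fintype V] (T : PlaneTree V)

/-- `j` is a descendant of `i`; every vertex is a descendant of itself. -/
def IsDescendant (i j : V) : Prop :=
  Relation.ReflTransGen (fun a b => b ∈ T.children a) i j

open Classical in
/-- The set of descendants of `i`. -/
noncomputable def descendants (i : V) : Finset V :=
  Finset.univ.filter (fun j => T.IsDescendant i j)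

open Classical in
theorem descendants_nonempty (i : V) : (T.descendants i).Nonempty :=
  ⟨i, Finset.mem_filter.mpr ⟨Finset.mem_univ i, Relation.ReflTransGen.refl⟩⟩

variable [LinearOrder V]

/-- `β_T(i)`: the smallest descendant of `i`. -/
noncomputable def beta (i : V) : V :=
  (T.descendants i).min' (T.descendants_nonempty i)

/-- `k` is a brother of `j` to its right: both are children of some vertex `v`, and `j` occurs
before `k` in the list of children of `v`. -/
def IsRightBrother (j k : V) : Prop :=
  ∃ v, List.Sublist [j, k] (T.children v)

/-- `j` is elder if it has a brother `k` to its right with `β_T(k) < β_T(j)`;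
otherwise `j` is younger. -/
def IsElder (j : V) : Prop :=
  ∃ k, T.IsRightBrother j k ∧ T.beta k < T.beta j

open Classical in
/-- `eld(T)`: the number of elder vertices of `T`. -/
noncomputable def eld : ℕ :=
  (Finset.univ.filter (fun j : V => T.IsElder j)).card

open Classical in
/-- `young_T(v)`: the number of younger children of `v`, i.e. the number of children of `v` minus
the number of elder children of `v`. -/
noncomputable def young (v : V) : ℕ :=
  (Finset.univ.filter (fun j : V => j ∈ T.children v ∧ ¬ T.IsElder j)).card

/-- The pair `(i, j)` is an improper edge of `T`: `j` is a child of `i`, and the edge is not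
proper, where proper means that `j` is elder or `i < β_T(j)`. -/
def IsImproperEdge (i j : V) : Prop :=
  j ∈ T.children i ∧ ¬ (T.IsElder j ∨ i < T.beta j)

open Classical in
/-- The number of improper edges of `T`. -/
noncomputable def imp : ℕ :=
  (Finset.univ.filter (fun e : V × V => T.IsImproperEdge e.1 e.2)).card

end Statistics

end PlaneTree

open Classical in
/-- `𝒫_{n,k}`: the set of plane trees on `[n]`, with any root, having `k` improper edges.
The labels `1 < 2 < ⋯ < n` are modelled by the elements `0 < 1 < ⋯ < n - 1` of `Fin n`. -/
noncomputable def planeTrees (n k : ℕ) : Finset (PlaneTree (Fin n)) :=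
  Finset.univ.filter (fun T => T.imp = k)

/-! Let W_n be the sum of x^young(1) t^eld y^imp over all plane trees on [n]. Under x ↦ x - t - 1
the operator that produces Q_{n+1} becomes x + (n-1)(1+t) + ny + (t+y) y∂_y, and y∂_y multiplies the
monomial of a tree by its number of improper edges. So the theorem is the coefficient of y^k in an
identity that follows by induction from `sum_weight_succ`: passing from W_n to W_{n+1} multiplies
the term of each T by x + (n-1)(1+t) + ny + imp(T)(t+y).

This recurrence comes from deleting the largest vertex m = n+1, according to its children. A leaf m
sits in one of 2n-1 slots of a tree on [n], and its edge is proper. In the n rightmost slots it is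
younger (x below vertex 1, factor 1 elsewhere); in the n-1 others it is elder (t). This is
`sum_leaf`. If m has one child, m subdivides the edge above a vertex or sits on top of the root: n
choices, each with one more improper edge (`sum_one_child`). If m has children l, a, b with β(a) >
β(b), merge m into a, with children l, b and then those of a; if β(a) < β(b), merge m into b, with
children l, a and then those of b. Either way the result is a tree with a marked improper edge (i,
j), and every such pair arises once from each case. Undoing the merge costs t in the first case,
since i becomes elder, and y in the second, since the edge (m, i) is improper (`sum_descent`,
`sum_ascent`).

The statistics are controllable because each is a sum over vertices v of a function of the list of
β-values of the children of v, and these surgeries change that list only at i and m. -/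

/-! ### Statistics of lists of numbers -/

/-- The number of entries of a list that exceed some later entry. -/
def elderCount : List ℕ → ℕ
  | [] => 0
  | a :: l => (if ∃ k ∈ l, k < a then 1 else 0) + elderCount l

/-- The number of entries of a list that exceed no later entry. -/
def youngerCount : List ℕ → ℕ
  | [] => 0
  | a :: l => (if ∃ k ∈ l, k < a then 0 else 1) + youngerCount l

/-- The number of entries of a list that are at most `i` and exceed no later entry. -/
def improperCount (i : ℕ) : List ℕ → ℕ
  | [] => 0
  | a :: l => (if a ≤ i ∧ ∀ k ∈ l, a ≤ k then 1 else 0) + improperCount i l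

/-- Entries of `l` see the tail `m` only through its minimum `c`, and a final `c` contributes
nothing itself. -/
theorem elderCount_append (l : List ℕ) {m : List ℕ} {c : ℕ} (hc : c ∈ m) (hm : ∀ k ∈ m, c ≤ k) :
    elderCount (l ++ m) = elderCount (l ++ [c]) + elderCount m := by
  induction l with
  | nil => simp [elderCount]
  | cons a l ih =>
    have : (∃ k ∈ l ++ m, k < a) ↔ ∃ k ∈ l ++ [c], k < a := by
      constructor
      · rintro ⟨k, hk, hka⟩
        rcases List.mem_append.1 hk with h | h
        · exact ⟨k, by simp [h], hka⟩
        · exact ⟨c, by simp, (hm k h).trans_lt hka⟩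
      · rintro ⟨k, hk, hka⟩
        rcases List.mem_append.1 hk with h | h
        · exact ⟨k, by simp [h], hka⟩
        · exact ⟨k, by simp_all, hka⟩
    simp only [List.cons_append, elderCount, this, ih]
    ring

/-- Again only the minimum of the tail matters to `l`; the summand 1 on the left compensates for the
final `c` of `l ++ [c]`, which is itself counted because `c ≤ i`. -/
theorem improperCount_append {i : ℕ} (l : List ℕ) {m : List ℕ} {c : ℕ} (hc : c ∈ m)
    (hm : ∀ k ∈ m, c ≤ k) (hi : c ≤ i) :
    improperCount i (l ++ m) + 1 = improperCount i (l ++ [c]) + improperCount i m := by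
  induction l with
  | nil => simp [improperCount, hi, add_comm]
  | cons a l ih =>
    have : (∀ k ∈ l ++ m, a ≤ k) ↔ ∀ k ∈ l ++ [c], a ≤ k := by
      constructor
      · intro h k hk
        rcases List.mem_append.1 hk with h' | h'
        · exact h k (by simp [h'])
        · exact h k (by simp_all)
      · intro h k hk
        rcases List.mem_append.1 hk with h' | h'
        · exact h k (by simp [h'])
        · exact (h c (by simp)).trans (hm k h')
    simp only [List.cons_append, improperCount, this]
    omega

/-- An entry that exceeds no later one is at most the final `c`, so it passes any threshold that `c`
passes. This is why children moved from one parent to another keep their improper edges. -/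
theorem improperCount_append_singleton {i i' c : ℕ} (l : List ℕ) (hi : c ≤ i) (hi' : c ≤ i') :
    improperCount i (l ++ [c]) = improperCount i' (l ++ [c]) := by
  induction l with
  | nil => simp [improperCount, hi, hi']
  | cons a l ih =>
    have : (a ≤ i ∧ ∀ k ∈ l ++ [c], a ≤ k) ↔ (a ≤ i' ∧ ∀ k ∈ l ++ [c], a ≤ k) :=
      and_congr_left fun h =>
        ⟨fun _ => (h c (by simp)).trans hi', fun _ => (h c (by simp)).trans hi⟩
    simp only [List.cons_append, improperCount, this, ih]

/-- A maximal entry makes no smaller entry elder, and is itself elder exactly when something follows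
it. -/
theorem elderCount_insert_max (l r : List ℕ) {N : ℕ} (hl : ∀ k ∈ l, k < N) (hr : ∀ k ∈ r, k < N) :
    elderCount (l ++ N :: r) = elderCount (l ++ r) + if r = [] then 0 else 1 := by
  induction l with
  | nil =>
    cases r with
    | nil => simp [elderCount]
    | cons b r =>
      have : ∃ k ∈ b :: r, k < N := ⟨b, by simp, hr b (by simp)⟩
      simp only [List.nil_append]
      rw [elderCount, if_pos this]
      simp [add_comm]
  | cons a l ih =>
    have ha := hl a (by simp)
    have : (∃ k ∈ l ++ N :: r, k < a) ↔ ∃ k ∈ l ++ r, k < a := by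
      simp [or_and_right, exists_or, ha.not_gt]
    simp only [List.cons_append, elderCount, this, ih fun k hk => hl k (by simp [hk])]
    ring

theorem youngerCount_insert_max (l r : List ℕ) {N : ℕ} (hl : ∀ k ∈ l, k < N)
    (hr : ∀ k ∈ r, k < N) :
    youngerCount (l ++ N :: r) = youngerCount (l ++ r) + if r = [] then 1 else 0 := by
  induction l with
  | nil =>
    cases r with
    | nil => simp [youngerCount]
    | cons b r =>
      have : ∃ k ∈ b :: r, k < N := ⟨b, by simp, hr b (by simp)⟩
      simp only [List.nil_append]
      rw [youngerCount, if_pos this]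
      simp
  | cons a l ih =>
    have ha := hl a (by simp)
    have : (∃ k ∈ l ++ N :: r, k < a) ↔ ∃ k ∈ l ++ r, k < a := by
      simp [or_and_right, exists_or, ha.not_gt]
    simp only [List.cons_append, youngerCount, this, ih fun k hk => hl k (by simp [hk])]
    ring

theorem improperCount_insert_max (l r : List ℕ) {N i : ℕ} (hl : ∀ k ∈ l, k < N) (hi : i < N) :
    improperCount i (l ++ N :: r) = improperCount i (l ++ r) := by
  induction l with
  | nil => simp [improperCount, hi]
  | cons a l ih =>
    have ha := hl a (by simp)
    have : (∀ k ∈ l ++ N :: r, a ≤ k) ↔ ∀ k ∈ l ++ r, a ≤ k := by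
      simp [or_imp, forall_and, ha.le]
    simp only [List.cons_append, improperCount, this, ih fun k hk => hl k (by simp [hk])]

/-! ### From sets of siblings to list statistics -/

namespace PlaneTree

variable {V : Type*}

theorem isRightBrother_iff (T : PlaneTree V) {i j k : V} (hj : j ∈ T.children i) :
    T.IsRightBrother j k ↔ [j, k].Sublist (T.children i) := by
  refine ⟨?_, fun h => ⟨i, h⟩⟩
  rintro ⟨v, hv⟩
  rwa [T.parent_unique i v j hj (hv.subset (by simp))]

end PlaneTree

theorem List.pair_sublist_cons_self {V : Type*} {a k : V} {l : List V} :
    [a, k].Sublist (a :: l) ↔ k ∈ l := by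
  rw [List.cons_sublist_cons, List.singleton_sublist]

theorem List.pair_sublist_cons_of_ne {V : Type*} {a j k : V} {l : List V} (h : j ≠ a) :
    [j, k].Sublist (a :: l) ↔ [j, k].Sublist l := by
  refine ⟨fun hs => ?_, fun hs => hs.cons a⟩
  cases hs with
  | cons _ h' => exact h'
  | cons_cons _ h' => exact absurd rfl h

/-- One step of a recursion along the list. `P` refers to brothers in `a :: l` and `Q` to brothers
in `l`; the two agree on `l` because prepending `a` adds no right brother. -/
theorem ncard_mem_cons {V : Type*} {a : V} {l : List V} (ha : a ∉ l)
    {P Q : V → Prop} [Decidable (P a)] (h : ∀ j ∈ l, P j ↔ Q j) :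
    {j | j ∈ a :: l ∧ P j}.ncard = (if P a then 1 else 0) + {j | j ∈ l ∧ Q j}.ncard := by
  have h1 : {j | j ∈ l ∧ Q j} = {j | j ∈ l ∧ P j} :=
    Set.ext fun j => and_congr_right fun hj => (h j hj).symm
  have hf : {j | j ∈ l ∧ P j}.Finite := l.finite_toSet.subset fun j hj => hj.1
  rw [h1]
  split_ifs with hp
  · rw [add_comm, ← Set.ncard_insert_of_notMem (a := a) (fun h => ha h.1) hf]
    congr 1
    ext j
    simp only [List.mem_cons, Set.mem_ofPred_eq, Set.mem_insert_iff, or_and_right]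
    exact or_congr_left (and_iff_left_of_imp fun h => h ▸ hp)
  · rw [zero_add]
    congr 1
    ext j
    simp only [List.mem_cons, Set.mem_ofPred_eq, or_and_right, or_iff_right_iff_imp]
    rintro ⟨rfl, h⟩
    exact absurd h hp

section SiblingLists

variable {V : Type*} (f : V → ℕ)

theorem exists_pair_sublist_cons {a j : V} {l : List V} (ha : a ∉ l) (hj : j ∈ l) :
    (∃ k, [j, k].Sublist (a :: l) ∧ f k < f j) ↔ ∃ k, [j, k].Sublist l ∧ f k < f j := by
  simp only [List.pair_sublist_cons_of_ne (ne_of_mem_of_not_mem hj ha)]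

theorem exists_pair_sublist_cons_self {a : V} {l : List V} :
    (∃ k, [a, k].Sublist (a :: l) ∧ f k < f a) ↔ ∃ k ∈ l.map f, k < f a := by
  simp only [List.pair_sublist_cons_self, List.mem_map, exists_exists_and_eq_and]

theorem ncard_elder {l : List V} (hl : l.Nodup) :
    {j | j ∈ l ∧ ∃ k, [j, k].Sublist l ∧ f k < f j}.ncard = elderCount (l.map f) := by
  classical
  induction l with
  | nil => simp [elderCount]
  | cons a l ih =>
    obtain ⟨ha, hl⟩ := List.nodup_cons.1 hl
    rw [ncard_mem_cons ha (fun j hj => exists_pair_sublist_cons f ha hj), ih hl,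
      List.map_cons, elderCount]
    simp only [exists_pair_sublist_cons_self]

theorem ncard_younger {l : List V} (hl : l.Nodup) :
    {j | j ∈ l ∧ ¬ ∃ k, [j, k].Sublist l ∧ f k < f j}.ncard = youngerCount (l.map f) := by
  classical
  induction l with
  | nil => simp [youngerCount]
  | cons a l ih =>
    obtain ⟨ha, hl⟩ := List.nodup_cons.1 hl
    rw [ncard_mem_cons ha (fun j hj => not_congr (exists_pair_sublist_cons f ha hj)), ih hl,
      List.map_cons, youngerCount]
    simp only [exists_pair_sublist_cons_self, ite_not]

theorem ncard_improper (i : ℕ) {l : List V} (hl : l.Nodup) :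
    {j | j ∈ l ∧ ¬ ((∃ k, [j, k].Sublist l ∧ f k < f j) ∨ i < f j)}.ncard
      = improperCount i (l.map f) := by
  classical
  induction l with
  | nil => simp [improperCount]
  | cons a l ih =>
    obtain ⟨ha, hl⟩ := List.nodup_cons.1 hl
    rw [ncard_mem_cons ha
      (fun j hj => not_congr (or_congr_left (exists_pair_sublist_cons f ha hj))), ih hl,
      List.map_cons, improperCount, exists_pair_sublist_cons_self]
    have hp : ¬ ((∃ k ∈ l.map f, k < f a) ∨ i < f a) ↔ f a ≤ i ∧ ∀ k ∈ l.map f, f a ≤ k := by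
      push Not
      exact and_comm
    simp only [hp]

end SiblingLists

/-! ### Ancestry in a plane tree -/

namespace PlaneTree

/-- A cycle through a vertex also passes through its unique parent, so it climbs up to the root,
which has no parent. -/
theorem mem_children_trans_ne {V : Type*} (T : PlaneTree V) (v : V) :
    ¬ Relation.TransGen (fun i j => j ∈ T.children i) v v := by
  induction T.reachable v with
  | refl =>
    intro h
    obtain ⟨c, -, hc⟩ := Relation.TransGen.tail'_iff.1 h
    exact T.root_not_child _ hc
  | @tail u w _ huw ih =>
    intro h
    obtain ⟨c, hc, hcw⟩ := Relation.TransGen.tail'_iff.1 h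
    rw [T.parent_unique c u w hcw huw] at hc
    exact ih (Relation.TransGen.head' huw hc)

theorem wellFounded_children {V : Type*} [Finite V] (T : PlaneTree V) :
    WellFounded (fun j i => j ∈ T.children i) := by
  have : IsTrans V (Relation.TransGen fun i j => j ∈ T.children i) := inferInstance
  have h : WellFounded (Function.swap (Relation.TransGen fun i j => j ∈ T.children i)) := by
    have : Std.Irrefl (Function.swap (Relation.TransGen fun i j => j ∈ T.children i)) :=
      ⟨fun v => T.mem_children_trans_ne v⟩
    exact Finite.wellFounded_of_trans_of_irrefl _
  exact Subrelation.wf (fun h => Relation.TransGen.single h) h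

theorem exists_parent {V : Type*} (T : PlaneTree V) {j : V} (hj : j ≠ T.root) :
    ∃ i, j ∈ T.children i := by
  rcases Relation.ReflTransGen.cases_tail (T.reachable j) with h | ⟨i, -, h⟩
  · exact absurd h hj
  · exact ⟨i, h⟩

/-- The ancestors of `w` form a chain because parents are unique, and two comparable siblings
coincide by acyclicity. -/
theorem eq_of_common_descendant {V : Type*} [Fintype V] (T : PlaneTree V) {p u v w : V}
    (hu : u ∈ T.children p) (hv : v ∈ T.children p) (huw : T.IsDescendant u w)
    (hvw : T.IsDescendant v w) : u = v := by
  have key : ∀ {a b : V}, a ∈ T.children p → b ∈ T.children p → T.IsDescendant a b → a = b := by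
    intro a b ha hb hab
    rcases Relation.ReflTransGen.cases_tail hab with h | ⟨c, hac, hcb⟩
    · exact h.symm
    · rw [T.parent_unique c p b hcb hb] at hac
      exact absurd (Relation.TransGen.head' ha hac) (T.mem_children_trans_ne p)
  have htot : T.IsDescendant u v ∨ T.IsDescendant v u := by
    clear hu hv key
    induction huw with
    | refl => exact Or.inr hvw
    | @tail b c hub hbc ih =>
      rcases Relation.ReflTransGen.cases_tail hvw with h | ⟨d, hvd, hdc⟩
      · exact Or.inl (h ▸ hub.tail hbc)
      · exact ih (T.parent_unique d b c hdc hbc ▸ hvd)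
  rcases htot with h | h
  · exact key hu hv h
  · exact (key hv hu h).symm

/-! ### Smallest descendants, and the statistics in terms of them -/

section Beta

variable {n : ℕ} (T : PlaneTree (Fin n))

/-- The smallest descendant of `v`, as a natural number. -/
noncomputable def minDesc (v : Fin n) : ℕ := (T.beta v : ℕ)

theorem isDescendant_beta (v : Fin n) : T.IsDescendant v (T.beta v) := by
  classical
  exact (Finset.mem_filter.1 ((T.descendants v).min'_mem (T.descendants_nonempty v))).2

theorem minDesc_le_of_isDescendant {v w : Fin n} (h : T.IsDescendant v w) :
    T.minDesc v ≤ w := by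
  classical
  exact Finset.min'_le _ _ (Finset.mem_filter.2 ⟨Finset.mem_univ _, h⟩)

theorem minDesc_le (v : Fin n) : T.minDesc v ≤ v :=
  T.minDesc_le_of_isDescendant Relation.ReflTransGen.refl

theorem minDesc_lt (v : Fin n) : T.minDesc v < n := (T.beta v).2

theorem minDesc_le_child {v c : Fin n} (h : c ∈ T.children v) : T.minDesc v ≤ T.minDesc c :=
  T.minDesc_le_of_isDescendant (Relation.ReflTransGen.head h (T.isDescendant_beta c))

theorem minDesc_eq_or (v : Fin n) :
    T.minDesc v = v ∨ ∃ c ∈ T.children v, T.minDesc v = T.minDesc c := by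
  rcases Relation.ReflTransGen.cases_head (T.isDescendant_beta v) with h | ⟨c, hc, hd⟩
  · exact Or.inl (congrArg Fin.val h.symm)
  · exact Or.inr ⟨c, hc, (T.minDesc_le_child hc).antisymm (T.minDesc_le_of_isDescendant hd)⟩

/-- The three conditions say that `f v` is the minimum of `v` and the values of `f` at the children,
a recursion with one solution by induction from the leaves. Thus β in a modified tree is found by
guessing it and checking locally. -/
theorem minDesc_unique {f : Fin n → ℕ} (h1 : ∀ v, f v ≤ v)
    (h2 : ∀ v, ∀ c ∈ T.children v, f v ≤ f c)
    (h3 : ∀ v, f v = v ∨ ∃ c ∈ T.children v, f v = f c) (v : Fin n) : T.minDesc v = f v := by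
  induction v using T.wellFounded_children.induction with
  | _ v ih =>
    apply le_antisymm
    · rcases h3 v with h | ⟨c, hc, h⟩
      · exact h ▸ T.minDesc_le v
      · rw [h, ← ih c hc]
        exact T.minDesc_le_child hc
    · rcases T.minDesc_eq_or v with h | ⟨c, hc, h⟩
      · exact h ▸ h1 v
      · rw [h, ih c hc]
        exact h2 v c hc

/-- Siblings have disjoint sets of descendants. -/
theorem minDesc_injOn_children {p u v : Fin n} (hu : u ∈ T.children p) (hv : v ∈ T.children p)
    (h : T.minDesc u = T.minDesc v) : u = v :=
  T.eq_of_common_descendant hu hv (T.isDescendant_beta u)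
    (Fin.ext h ▸ T.isDescendant_beta v)

/-- The list of the smallest descendants of the children of `v`. -/
noncomputable def betaList (v : Fin n) : List ℕ := (T.children v).map T.minDesc

theorem isElder_iff {i j : Fin n} (hj : j ∈ T.children i) :
    T.IsElder j ↔ ∃ k, [j, k].Sublist (T.children i) ∧ T.minDesc k < T.minDesc j := by
  simp only [IsElder, T.isRightBrother_iff hj]
  rfl

theorem young_eq (v : Fin n) : T.young v = youngerCount (T.betaList v) := by
  rw [betaList, ← ncard_younger _ (T.nodup_children v), young, ← Set.ncard_coe_finset,
    Finset.coe_filter_univ]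
  congr 1
  exact Set.ext fun j => and_congr_right fun hj => not_congr (T.isElder_iff hj)

/-- An elder vertex has a brother, hence a parent, and this parent is unique; so elder vertices can
be counted parent by parent. -/
theorem eld_eq : T.eld = ∑ v, elderCount (T.betaList v) := by
  classical
  have h (v : Fin n) : elderCount (T.betaList v)
      = (Finset.univ.filter fun j => j ∈ T.children v ∧ T.IsElder j).card := by
    rw [betaList, ← ncard_elder _ (T.nodup_children v), ← Set.ncard_coe_finset,
      Finset.coe_filter_univ]
    congr 1
    exact Set.ext fun j => and_congr_right fun hj => (T.isElder_iff hj).symm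
  simp only [h, eld]
  rw [← Finset.card_biUnion]
  · congr 1
    ext j
    simp only [Finset.mem_filter, Finset.mem_univ, true_and, Finset.mem_biUnion,
      exists_and_right, iff_and_self]
    rintro ⟨k, ⟨v, hv⟩, -⟩
    exact ⟨v, hv.subset (by simp)⟩
  · intro v _ w _ hvw
    rw [Function.onFun, Finset.disjoint_left]
    intro j hj hj'
    exact hvw (T.parent_unique v w j (Finset.mem_filter.1 hj).2.1 (Finset.mem_filter.1 hj').2.1)

theorem imp_eq : T.imp = ∑ v : Fin n, improperCount v (T.betaList v) := by
  classical
  have h (v : Fin n) : improperCount v (T.betaList v)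
      = (Finset.univ.filter fun j => T.IsImproperEdge v j).card := by
    rw [betaList, ← ncard_improper _ _ (T.nodup_children v), ← Set.ncard_coe_finset,
      Finset.coe_filter_univ]
    congr 1
    refine Set.ext fun j => and_congr_right fun hj => ?_
    rw [T.isElder_iff hj]
    rfl
  simp only [h, imp]
  rw [← Finset.card_sigma]
  refine Finset.card_bij (fun e _ => ⟨e.1, e.2⟩) ?_ ?_ ?_
  · rintro ⟨i, j⟩ h
    simpa using h
  · rintro ⟨i, j⟩ _ ⟨i', j'⟩ _ h
    simpa using h
  · rintro ⟨i, j⟩ h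
    exact ⟨(i, j), by simpa using h, rfl⟩

end Beta

/-! ### Plane trees as a multiset identity plus reachability -/

section Validity

variable {V : Type*} [Fintype V]

/-- This single identity packs together the absence of repeated children, the uniqueness of parents
and the exclusion of the root; `ofMultiset` is the converse. Surgery on trees then becomes multiset
algebra. -/
theorem root_cons_sum_children (T : PlaneTree V) :
    T.root ::ₘ ∑ v, (T.children v : Multiset V) = Finset.univ.val := by
  classical
  ext j
  rw [Multiset.count_cons, Multiset.count_sum', Multiset.count_univ]
  simp only [Multiset.coe_count]
  by_cases hj : j = T.root
  · rw [if_pos hj, Finset.sum_eq_zero]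
    intro v _
    exact List.count_eq_zero.2 (hj ▸ T.root_not_child v)
  · obtain ⟨p, hp⟩ := T.exists_parent hj
    rw [if_neg hj, Finset.sum_eq_single p, List.count_eq_one_of_mem (T.nodup_children p) hp]
    · intro v _ hv
      exact List.count_eq_zero.2 fun h => hv (T.parent_unique v p j h hp)
    · simp

/-- A plane tree from a root and lists of children in which every vertex occurs exactly once. -/
def ofMultiset (root : V) (children : V → List V)
    (h : root ::ₘ ∑ v, (children v : Multiset V) = Finset.univ.val)
    (reachable : ∀ v, Relation.ReflTransGen (fun i j => j ∈ children i) root v) : PlaneTree V where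
  root := root
  children := children
  reachable := reachable
  nodup_children v := by
    have : (children v : Multiset V) ≤ Finset.univ.val := by
      rw [← h]
      exact (Finset.single_le_sum (f := fun v => (children v : Multiset V))
        (fun _ _ => Multiset.zero_le _) (Finset.mem_univ v)).trans (Multiset.le_cons_self _ _)
    exact Multiset.coe_nodup.1 (Multiset.nodup_of_le this Finset.univ.nodup)
  parent_unique i i' j hi hi' := by
    classical
    by_contra hne
    have : (children i + children i' : Multiset V) ≤ Finset.univ.val := by
      rw [← h, ← Finset.sum_pair (f := fun v => (children v : Multiset V)) hne]
      exact (Finset.sum_le_sum_of_subset (Finset.subset_univ _)).trans (Multiset.le_cons_self _ _)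
    have hd := (Multiset.nodup_add.1 (Multiset.nodup_of_le this Finset.univ.nodup)).2.2
    exact Multiset.disjoint_left.1 hd (Multiset.mem_coe.2 hi) (Multiset.mem_coe.2 hi')
  root_not_child i hi := by
    have hn := Finset.univ.nodup (α := V)
    rw [← h, Multiset.nodup_cons] at hn
    exact hn.1 (Multiset.mem_sum.2 ⟨i, Finset.mem_univ _, hi⟩)

theorem sum_length_children (T : PlaneTree V) :
    ∑ v, (T.children v).length + 1 = Fintype.card V := by
  have := congrArg Multiset.card T.root_cons_sum_children
  simpa using this

end Validity

end PlaneTree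

/-! ### Grafting the largest vertex above a vertex, and its inverse -/

namespace PlaneTree

theorem notMem_children_self {V : Type*} (T : PlaneTree V) (v : V) : v ∉ T.children v :=
  fun h => T.mem_children_trans_ne v (Relation.TransGen.single h)

theorem exists_map_castSucc {n : ℕ} {l : List (Fin (n + 1))} (h : Fin.last n ∉ l) :
    ∃ m : List (Fin n), m.map Fin.castSucc = l := by
  induction l with
  | nil => exact ⟨[], rfl⟩
  | cons a l ih =>
    obtain ⟨m, rfl⟩ := ih fun hl => h (List.mem_cons_of_mem _ hl)
    obtain ⟨b, rfl⟩ := Fin.exists_castSucc_eq.2 fun ha => h (ha ▸ List.mem_cons_self)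
    exact ⟨b :: m, rfl⟩

theorem last_notMem_map_castSucc {n : ℕ} (l : List (Fin n)) :
    Fin.last n ∉ l.map Fin.castSucc := by
  simp [Fin.castSucc_ne_last]

theorem univ_val_succ (n : ℕ) :
    (Finset.univ : Finset (Fin (n + 1))).val
      = Fin.last n ::ₘ (Finset.univ : Finset (Fin n)).val.map Fin.castSucc := by
  rw [Fin.univ_castSuccEmb]
  rfl

/-- The overwritten value is added on the left, since multisets have no genuine subtraction. -/
theorem sum_update_add {ι M : Type*} [Fintype ι] [DecidableEq ι] [AddCommMonoid M] (f : ι → M)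
    (i : ι) (b : M) : ∑ v, Function.update f i b v + f i = ∑ v, f v + b := by
  rw [Finset.sum_update_of_mem (Finset.mem_univ i),
    ← Finset.sum_sdiff (Finset.subset_univ {i}), Finset.sum_singleton]
  abel

theorem sum_coe_map {ι α β : Type*} [Fintype ι] (f : α → β) (l : ι → List α) :
    ∑ v, (((l v).map f : List β) : Multiset β) = (∑ v, (l v : Multiset α)).map f := by
  rw [← Multiset.coe_mapAddMonoidHom, map_sum]
  rfl

variable {n : ℕ}

section Graft

/-- The embedding of the vertices that puts the new largest vertex in the place of `i`. -/
def substLast (i : Fin n) : Fin n → Fin (n + 1) := Function.update Fin.castSucc i (Fin.last n)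

theorem substLast_self (i : Fin n) : substLast i i = Fin.last n := Function.update_self ..

theorem substLast_of_ne {i v : Fin n} (h : v ≠ i) : substLast i v = v.castSucc :=
  Function.update_of_ne h ..

theorem substLast_injective (i : Fin n) : Function.Injective (substLast i) := by
  intro u v h
  by_cases hu : u = i <;> by_cases hv : v = i
  · rw [hu, hv]
  · rw [hu, substLast_self, substLast_of_ne hv] at h
    exact absurd h.symm (Fin.castSucc_ne_last v)
  · rw [hv, substLast_self, substLast_of_ne hu] at h
    exact absurd h (Fin.castSucc_ne_last u)
  · rw [substLast_of_ne hu, substLast_of_ne hv] at h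
    exact Fin.castSucc_injective _ h

theorem map_substLast {i : Fin n} {l : List (Fin n)} (h : i ∉ l) :
    l.map (substLast i) = l.map Fin.castSucc :=
  List.map_congr_left fun _ hv => substLast_of_ne (ne_of_mem_of_not_mem hv h)

/-- The embedding `substLast i` misses exactly `i.castSucc`, the vertex that is put back as a child
of the last one. -/
theorem map_substLast_univ (i : Fin n) :
    i.castSucc ::ₘ (Finset.univ : Finset (Fin n)).val.map (substLast i)
      = (Finset.univ : Finset (Fin (n + 1))).val := by
  have h : (Finset.univ : Finset (Fin n)).val = i ::ₘ (Finset.univ.erase i).val := by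
    rw [Finset.erase_val, Multiset.cons_erase (Finset.mem_univ i)]
  have h' : (Finset.univ.erase i).val.map (substLast i)
      = (Finset.univ.erase i).val.map Fin.castSucc :=
    Multiset.map_congr rfl fun v hv => substLast_of_ne (Finset.ne_of_mem_erase (Finset.mem_def.2 hv))
  rw [univ_val_succ, h, Multiset.map_cons, Multiset.map_cons, substLast_self, h',
    Multiset.cons_swap]

/-- The lists of children after the vertex `i` has been replaced by the new largest vertex, which
gets the children `N`, while `i` gets the children `r`. -/
def graftChildren (T : PlaneTree (Fin n)) (i : Fin n) (N r : List (Fin n)) :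
    Fin (n + 1) → List (Fin (n + 1)) :=
  Fin.snoc (α := fun _ => List (Fin (n + 1)))
    (Function.update (fun v => (T.children v).map (substLast i)) i (r.map Fin.castSucc))
    (N.map Fin.castSucc)

variable (T : PlaneTree (Fin n)) {i : Fin n} {N r : List (Fin n)}

theorem graftChildren_last : T.graftChildren i N r (Fin.last n) = N.map Fin.castSucc :=
  Fin.snoc_last ..

theorem graftChildren_self : T.graftChildren i N r i.castSucc = r.map Fin.castSucc := by
  rw [graftChildren, Fin.snoc_castSucc, Function.update_self]

theorem graftChildren_of_ne {v : Fin n} (h : v ≠ i) :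
    T.graftChildren i N r v.castSucc = (T.children v).map (substLast i) := by
  rw [graftChildren, Fin.snoc_castSucc, Function.update_of_ne h]

theorem graft_multiset (h : (N ++ r).Perm (i :: T.children i)) :
    substLast i T.root ::ₘ ∑ v, (T.graftChildren i N r v : Multiset (Fin (n + 1)))
      = Finset.univ.val := by
  have hperm : (N.map Fin.castSucc : Multiset (Fin (n + 1))) + (r.map Fin.castSucc : List _)
      = i.castSucc ::ₘ ((T.children i).map (substLast i) : List _) := by
    rw [map_substLast (T.notMem_children_self i), Multiset.coe_add, ← List.map_append,
      Multiset.cons_coe, ← List.map_cons, Multiset.coe_eq_coe]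
    exact h.map _
  have hs : ∑ v : Fin n, (T.graftChildren i N r v.castSucc : Multiset (Fin (n + 1)))
        + ((T.children i).map (substLast i) : List _)
      = (∑ v, (T.children v : Multiset (Fin n))).map (substLast i)
        + (r.map Fin.castSucc : List _) := by
    have := sum_update_add (fun v =>
      (((T.children v).map (substLast i) : List _) : Multiset (Fin (n + 1)))) i
      (r.map Fin.castSucc : List _)
    rw [← sum_coe_map, ← this]
    congr 1
    refine Finset.sum_congr rfl fun v _ => ?_
    by_cases hv : v = i
    · rw [hv, graftChildren_self, Function.update_self]
    · rw [graftChildren_of_ne _ hv, Function.update_of_ne hv]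
  rw [Fin.sum_univ_castSucc, graftChildren_last, ← map_substLast_univ i,
    ← T.root_cons_sum_children, Multiset.map_cons]
  apply add_right_cancel (b := (((T.children i).map (substLast i) : List _) : Multiset _))
  rw [Multiset.cons_add, add_right_comm, hs, add_assoc, add_comm (Multiset.ofList _), hperm]
  simp only [← Multiset.singleton_add]
  abel

theorem graft_reachable (hi : i ∈ N) (h : (N ++ r).Perm (i :: T.children i)) (v : Fin (n + 1)) :
    Relation.ReflTransGen (fun a b => b ∈ T.graftChildren i N r a) (substLast i T.root) v := by
  -- The images under `substLast i` and `castSucc` differ only at `i`, and there one more step leads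
  -- from the last vertex to its child `i`.
  have up : ∀ v, Relation.ReflTransGen (fun a b => b ∈ T.graftChildren i N r a)
      (substLast i T.root) (substLast i v) → Relation.ReflTransGen
      (fun a b => b ∈ T.graftChildren i N r a) (substLast i T.root) v.castSucc := by
    intro v hv
    by_cases hvi : v = i
    · subst hvi
      rw [substLast_self] at hv
      refine hv.tail ?_
      rw [graftChildren_last]
      exact List.mem_map_of_mem hi
    · rwa [substLast_of_ne hvi] at hv
  have key : ∀ v, Relation.ReflTransGen (fun a b => b ∈ T.graftChildren i N r a)
      (substLast i T.root) (substLast i v) := by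
    intro v
    induction T.reachable v with
    | refl => exact .refl
    | @tail a b _ hab ih =>
      by_cases ha : a = i
      · subst ha
        have hb : b ∈ N ++ r := h.mem_iff.2 (List.mem_cons_of_mem _ hab)
        rw [substLast_of_ne (ne_of_mem_of_not_mem hab (T.notMem_children_self a))]
        rcases List.mem_append.1 hb with hb | hb
        · rw [substLast_self] at ih
          refine ih.tail ?_
          rw [graftChildren_last]
          exact List.mem_map_of_mem hb
        · refine (up a ih).tail ?_
          rw [graftChildren_self]
          exact List.mem_map_of_mem hb
      · refine (up a ih).tail ?_
        rw [graftChildren_of_ne _ ha]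
        exact List.mem_map_of_mem hab
  refine Fin.lastCases ?_ (fun v => up v (key v)) v
  exact substLast_self i ▸ key i

/-- The tree in which the vertex `i` has been replaced by the new largest vertex, which gets the
children `N`, among them `i`, while `i` keeps the children `r`. -/
def graft (i : Fin n) (N r : List (Fin n)) (hi : i ∈ N)
    (h : (N ++ r).Perm (i :: T.children i)) : PlaneTree (Fin (n + 1)) :=
  ofMultiset (substLast i T.root) (T.graftChildren i N r) (T.graft_multiset h)
    (T.graft_reachable hi h)

/-- Away from `i` the child lists are only relabelled. The order of the list at `i` is not
determined by `N` and `r`, which are a mere permutation of it with `i` added, so it is assumed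
equal. -/
theorem graft_ext {T₁ T₂ : PlaneTree (Fin n)} {N₁ N₂ r₁ r₂ : List (Fin n)} {hi₁ h₁ hi₂ h₂}
    (h : T₁.graft i N₁ r₁ hi₁ h₁ = T₂.graft i N₂ r₂ hi₂ h₂)
    (hc : T₁.children i = T₂.children i) : T₁ = T₂ := by
  have hr : substLast i T₁.root = substLast i T₂.root := congrArg root h
  have hch : T₁.graftChildren i N₁ r₁ = T₂.graftChildren i N₂ r₂ := congrArg children h
  refine PlaneTree.ext (substLast_injective i hr) (funext fun v => ?_)
  by_cases hv : v = i
  · rw [hv, hc]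
  · have := congrFun hch v.castSucc
    rw [graftChildren_of_ne _ hv, graftChildren_of_ne _ hv] at this
    exact (List.map_injective_iff.2 (substLast_injective i)) this

theorem graft_new_eq {T₁ T₂ : PlaneTree (Fin n)} {i₁ i₂ : Fin n} {N₁ N₂ r₁ r₂ : List (Fin n)}
    {hi₁ h₁ hi₂ h₂} (h : T₁.graft i₁ N₁ r₁ hi₁ h₁ = T₂.graft i₂ N₂ r₂ hi₂ h₂) : N₁ = N₂ := by
  have hch : T₁.graftChildren i₁ N₁ r₁ = T₂.graftChildren i₂ N₂ r₂ := congrArg children h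
  have := congrFun hch (Fin.last n)
  rw [graftChildren_last, graftChildren_last] at this
  exact (List.map_injective_iff.2 (Fin.castSucc_injective n)) this

theorem graft_kept_eq {T₁ T₂ : PlaneTree (Fin n)} {N₁ N₂ r₁ r₂ : List (Fin n)}
    {hi₁ h₁ hi₂ h₂} (h : T₁.graft i N₁ r₁ hi₁ h₁ = T₂.graft i N₂ r₂ hi₂ h₂) : r₁ = r₂ := by
  have hch : T₁.graftChildren i N₁ r₁ = T₂.graftChildren i N₂ r₂ := congrArg children h
  have := congrFun hch i.castSucc
  rw [graftChildren_self, graftChildren_self] at this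
  exact (List.map_injective_iff.2 (Fin.castSucc_injective n)) this

theorem graft_children_last {hi h} :
    (T.graft i N r hi h).children (Fin.last n) = N.map Fin.castSucc :=
  T.graftChildren_last

theorem graft_children_self {hi h} :
    (T.graft i N r hi h).children i.castSucc = r.map Fin.castSucc :=
  T.graftChildren_self

theorem graft_children_of_ne {hi h} {v : Fin n} (hv : v ≠ i) :
    (T.graft i N r hi h).children v.castSucc = (T.children v).map (substLast i) :=
  T.graftChildren_of_ne hv

/-- The last vertex takes over the whole subtree of `i`, so it inherits the β of `i` and nothing
changes higher up. The vertex `i` keeps only itself and the subtrees of `r`, so its β is the minimum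
over these. -/
theorem minDesc_graft (hi : i ∈ N) (h : (N ++ r).Perm (i :: T.children i)) :
    (∀ v, (T.graft i N r hi h).minDesc (substLast i v) = T.minDesc v) ∧
    ((T.graft i N r hi h).minDesc i.castSucc = i ∨
      ∃ c ∈ r, (T.graft i N r hi h).minDesc i.castSucc = T.minDesc c) ∧
    (T.graft i N r hi h).minDesc i.castSucc ≤ i ∧
    (∀ c ∈ r, (T.graft i N r hi h).minDesc i.castSucc ≤ T.minDesc c) := by
  -- With `l = r`, the value `g` will be the β of `i` in the new tree.
  have hmin : ∀ l : List (Fin n), ∃ g : ℕ, g ≤ i ∧ (∀ c ∈ l, g ≤ T.minDesc c) ∧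
      (g = i ∨ ∃ c ∈ l, g = T.minDesc c) := by
    intro l
    induction l with
    | nil => exact ⟨i, le_rfl, by simp, Or.inl rfl⟩
    | cons a l ih =>
      obtain ⟨g, hg, hl, hor⟩ := ih
      rcases le_total g (T.minDesc a) with hga | hga
      · refine ⟨g, hg, by simpa [hga] using hl, hor.imp_right ?_⟩
        rintro ⟨c, hc, h⟩
        exact ⟨c, List.mem_cons_of_mem _ hc, h⟩
      · refine ⟨T.minDesc a, hga.trans hg, ?_, Or.inr ⟨a, List.mem_cons_self, rfl⟩⟩
        simpa using fun c hc => hga.trans (hl c hc)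
  obtain ⟨g, hg, hgr, hor⟩ := hmin r
  let f : Fin (n + 1) → ℕ :=
    Fin.snoc (α := fun _ => ℕ) (Function.update T.minDesc i g) (T.minDesc i)
  have f_self : f i.castSucc = g := by simp [f]
  have f_ne : ∀ v, v ≠ i → f v.castSucc = T.minDesc v := fun v hv => by simp [f, hv]
  have f_last : f (Fin.last n) = T.minDesc i := Fin.snoc_last ..
  have f_subst : ∀ v, f (substLast i v) = T.minDesc v := by
    intro v
    by_cases hv : v = i
    · rw [hv, substLast_self, f_last]
    · rw [substLast_of_ne hv, f_ne v hv]
  have hN : ∀ c ∈ N, c ≠ i → c ∈ T.children i := fun c hc hci =>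
    (List.mem_cons.1 (h.mem_iff.1 (List.mem_append_left _ hc))).resolve_left hci
  have hnd : (N ++ r).Nodup :=
    h.nodup_iff.2 (List.nodup_cons.2 ⟨T.notMem_children_self i, T.nodup_children i⟩)
  have hir : i ∉ r := fun hr => List.disjoint_of_nodup_append hnd hi hr
  have hr : ∀ c ∈ r, c ≠ i ∧ c ∈ T.children i := fun c hc =>
    have hci := ne_of_mem_of_not_mem hc hir
    ⟨hci, (List.mem_cons.1 (h.mem_iff.1 (List.mem_append_right _ hc))).resolve_left hci⟩
  have hig : T.minDesc i ≤ g := by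
    rcases hor with h | ⟨c, hc, h⟩
    · exact h ▸ T.minDesc_le i
    · exact h ▸ T.minDesc_le_child (hr c hc).2
  have key := (T.graft i N r hi h).minDesc_unique (f := f) ?_ ?_ ?_
  · refine ⟨fun v => (key _).trans (f_subst v), ?_⟩
    rw [key, f_self]
    exact ⟨hor, hg, hgr⟩
  · refine Fin.lastCases ?_ fun v => ?_
    · rw [f_last]
      exact (T.minDesc_lt i).le
    · by_cases hv : v = i
      · rw [hv, f_self]
        exact hg
      · rw [f_ne v hv]
        exact T.minDesc_le v
  · refine Fin.lastCases ?_ fun v => ?_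
    · rw [graft_children_last, f_last, List.forall_mem_map]
      intro c hc
      by_cases hci : c = i
      · rw [hci, f_self]
        exact hig
      · rw [f_ne c hci]
        exact T.minDesc_le_child (hN c hc hci)
    · by_cases hv : v = i
      · rw [hv, graft_children_self, f_self, List.forall_mem_map]
        intro c hc
        rw [f_ne c (hr c hc).1]
        exact hgr c hc
      · rw [graft_children_of_ne _ hv, f_ne v hv, List.forall_mem_map]
        intro c hc
        rw [f_subst]
        exact T.minDesc_le_child hc
  · refine Fin.lastCases ?_ fun v => ?_
    · right
      rw [graft_children_last, f_last]
      simp only [List.mem_map, exists_exists_and_eq_and]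
      by_cases hgi : g = T.minDesc i
      -- If `g` is the old β of `i`, the child `i` attains it. Otherwise a child from `N` must,
      -- since neither `i` itself nor a subtree in `r` does.
      · exact ⟨i, hi, by rw [f_self, hgi]⟩
      · rcases T.minDesc_eq_or i with h' | ⟨c, hc, h'⟩
        · exact absurd (le_antisymm (hg.trans h'.ge) hig) hgi
        · rcases List.mem_append.1 (h.mem_iff.2 (List.mem_cons_of_mem _ hc)) with hc' | hc'
          · refine ⟨c, hc', ?_⟩
            rw [f_ne c (ne_of_mem_of_not_mem hc (T.notMem_children_self i)), h']
          · exact absurd (le_antisymm ((hgr c hc').trans h'.ge) hig) hgi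
    · by_cases hv : v = i
      · rw [hv, graft_children_self, f_self]
        refine hor.imp id ?_
        rintro ⟨c, hc, h⟩
        refine ⟨c.castSucc, List.mem_map_of_mem hc, ?_⟩
        rw [f_ne c (hr c hc).1, h]
      · rw [graft_children_of_ne _ hv, f_ne v hv]
        refine (T.minDesc_eq_or v).imp id ?_
        rintro ⟨c, hc, h⟩
        exact ⟨_, List.mem_map_of_mem hc, by rw [f_subst, h]⟩

/-- Contract the edge from the last vertex to its child `a`, giving the merged vertex the prescribed
child list `cs`. -/
theorem exists_graft_eq (S : PlaneTree (Fin (n + 1))) {a : Fin n} {N r cs : List (Fin n)}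
    (hN : S.children (Fin.last n) = N.map Fin.castSucc)
    (hr : S.children a.castSucc = r.map Fin.castSucc) (ha : a ∈ N)
    (hcs : (N ++ r).Perm (a :: cs)) :
    ∃ (T : PlaneTree (Fin n)) (hc : T.children a = cs),
      T.graft a N r ha (hc ▸ hcs) = S := by
  -- The contraction map: it sends the last vertex to `a` and fixes the others.
  let φ : Fin (n + 1) → Fin n := Fin.snoc (α := fun _ => Fin n) id a
  have φ_last : φ (Fin.last n) = a := by simp [φ]
  have φ_cast : ∀ v : Fin n, φ v.castSucc = v := fun v => by simp [φ]
  have φ_map : ∀ l : List (Fin n), (l.map Fin.castSucc).map φ = l := fun l => by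
    rw [List.map_map, show φ ∘ Fin.castSucc = id from funext φ_cast, List.map_id]
  let ch : Fin n → List (Fin n) := Function.update (fun v => (S.children v.castSucc).map φ) a cs
  have ch_self : ch a = cs := Function.update_self ..
  have ch_ne : ∀ v, v ≠ a → ch v = (S.children v.castSucc).map φ :=
    fun v hv => Function.update_of_ne hv ..
  have ha' : a.castSucc ∈ S.children (Fin.last n) := hN ▸ List.mem_map_of_mem ha
  have a_notMem : ∀ w ≠ Fin.last n, a.castSucc ∉ S.children w := fun w hw h =>
    hw (S.parent_unique _ _ _ h ha')
  have root_ne : S.root ≠ a.castSucc := fun h => S.root_not_child _ (h ▸ ha')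
  have subst_φ : ∀ v, v ≠ a.castSucc → substLast a (φ v) = v := by
    refine Fin.lastCases ?_ fun v hv => ?_
    · intro _
      rw [φ_last, substLast_self]
    · rw [φ_cast, substLast_of_ne fun h => hv (congrArg _ h)]
  have hmult : φ S.root ::ₘ ∑ v, (ch v : Multiset (Fin n)) = Finset.univ.val := by
    have h1 := congrArg (Multiset.map φ) S.root_cons_sum_children
    rw [univ_val_succ, Fin.sum_univ_castSucc, hN, Multiset.map_cons, Multiset.map_cons,
      Multiset.map_map, show φ ∘ Fin.castSucc = id from funext φ_cast, Multiset.map_id, φ_last,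
      Multiset.map_add, Multiset.map_coe, φ_map, ← sum_coe_map] at h1
    have h2 : ∑ v, (ch v : Multiset (Fin n)) + (r : Multiset (Fin n))
        = ∑ v : Fin n, (((S.children v.castSucc).map φ : List _) : Multiset (Fin n)) + (cs : Multiset (Fin n)) := by
      have := sum_update_add (fun v : Fin n =>
        (((S.children v.castSucc).map φ : List _) : Multiset (Fin n))) a cs
      rw [hr, φ_map] at this
      rw [← this]
      congr 1
      refine Finset.sum_congr rfl fun v _ => ?_
      by_cases hv : v = a
      · rw [hv, ch_self, Function.update_self]
      · rw [ch_ne v hv, Function.update_of_ne hv]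
    have h3 : (N : Multiset (Fin n)) + r = a ::ₘ (cs : Multiset (Fin n)) := by
      rw [Multiset.coe_add, Multiset.cons_coe, Multiset.coe_eq_coe]
      exact hcs
    -- `φ` takes the value `a` twice, at the last vertex and at `a` itself, so the identity carried
    -- over from `S` has an extra copy of `a`.
    apply add_left_cancel (a := ({a} : Multiset (Fin n)))
    rw [Multiset.singleton_add a Finset.univ.val, ← h1]
    apply add_right_cancel (b := (r : Multiset (Fin n)))
    simp only [← Multiset.singleton_add] at h3 ⊢
    calc _ = {a} + {φ S.root} + (∑ v, (ch v : Multiset (Fin n)) + r) := by abel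
      _ = {φ S.root} + ∑ v : Fin n, (((S.children v.castSucc).map φ : List _) : Multiset (Fin n))
          + ({a} + (cs : Multiset (Fin n))) := by rw [h2]; abel
      _ = _ := by rw [← h3]; abel
  have hreach : ∀ v, Relation.ReflTransGen (fun i j => j ∈ ch i) (φ S.root) v := by
    have key : ∀ v, Relation.ReflTransGen (fun i j => j ∈ ch i) (φ S.root) (φ v) := by
      intro v
      induction S.reachable v with
      | refl => exact .refl
      | @tail b c _ hbc ih =>
        have hmem : ∀ d, d ∈ N ++ r → φ b = a →
            Relation.ReflTransGen (fun i j => j ∈ ch i) (φ S.root) d := by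
          intro d hd hb
          rcases List.mem_cons.1 (hcs.mem_iff.1 hd) with h | h
          · rw [h, ← hb]
            exact ih
          · refine ih.tail ?_
            rw [hb, ch_self]
            exact h
        induction b using Fin.lastCases with
        | last =>
          rw [hN] at hbc
          obtain ⟨d, hd, rfl⟩ := List.mem_map.1 hbc
          rw [φ_cast]
          exact hmem d (List.mem_append_left _ hd) φ_last
        | cast b =>
          by_cases hb : b = a
          · subst hb
            rw [hr] at hbc
            obtain ⟨d, hd, rfl⟩ := List.mem_map.1 hbc
            rw [φ_cast]
            exact hmem d (List.mem_append_right _ hd) (φ_cast b)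
          · refine ih.tail ?_
            rw [φ_cast, ch_ne b hb]
            exact List.mem_map_of_mem hbc
    intro v
    rw [← φ_cast v]
    exact key _
  refine ⟨ofMultiset (φ S.root) ch hmult hreach, ch_self, ?_⟩
  refine PlaneTree.ext (subst_φ _ root_ne) (funext fun v => ?_)
  induction v using Fin.lastCases with
  | last => rw [graft_children_last, hN]
  | cast v =>
    by_cases hv : v = a
    · rw [hv, graft_children_self, hr]
    · rw [graft_children_of_ne _ hv]
      change (ch v).map _ = _
      rw [ch_ne v hv, List.map_map]
      refine (List.map_congr_left fun w hw => ?_).trans (List.map_id _)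
      exact subst_φ w (ne_of_mem_of_not_mem hw (a_notMem _ (Fin.castSucc_ne_last v)))

end Graft

end PlaneTree

/-! ### Adding a largest leaf, and its inverse -/

namespace PlaneTree

variable {n : ℕ}

section AddLeaf

/-- The lists of children after a new largest leaf has been inserted among the children of `i`,
between the lists `l` and `r`. -/
def addLeafChildren (T : PlaneTree (Fin n)) (i : Fin n) (l r : List (Fin n)) :
    Fin (n + 1) → List (Fin (n + 1)) :=
  Fin.snoc (α := fun _ => List (Fin (n + 1)))
    (Function.update (fun v => (T.children v).map Fin.castSucc) i
      (l.map Fin.castSucc ++ Fin.last n :: r.map Fin.castSucc))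
    []

variable (T : PlaneTree (Fin n)) {i : Fin n} {l r : List (Fin n)}

theorem addLeafChildren_last : T.addLeafChildren i l r (Fin.last n) = [] :=
  Fin.snoc_last ..

theorem addLeafChildren_self : T.addLeafChildren i l r i.castSucc
    = l.map Fin.castSucc ++ Fin.last n :: r.map Fin.castSucc := by
  rw [addLeafChildren, Fin.snoc_castSucc, Function.update_self]

theorem addLeafChildren_of_ne {v : Fin n} (h : v ≠ i) :
    T.addLeafChildren i l r v.castSucc = (T.children v).map Fin.castSucc := by
  rw [addLeafChildren, Fin.snoc_castSucc, Function.update_of_ne h]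

theorem sum_update_cons_last (ch : Fin n → List (Fin n)) (i : Fin n) :
    ∑ v, Function.update
        (fun v => (((ch v).map Fin.castSucc : List (Fin (n + 1))) : Multiset (Fin (n + 1)))) i
        (Fin.last n ::ₘ ((ch i).map Fin.castSucc : List _)) v
      = Fin.last n ::ₘ (∑ v, (ch v : Multiset (Fin n))).map Fin.castSucc := by
  have h := sum_update_add (fun v =>
    (((ch v).map Fin.castSucc : List (Fin (n + 1))) : Multiset (Fin (n + 1)))) i
    (Fin.last n ::ₘ ((ch i).map Fin.castSucc : List _))
  rw [Multiset.add_cons, ← Multiset.cons_add] at h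
  rw [add_right_cancel h, sum_coe_map]

theorem coe_append_last_cons (l r : List (Fin n)) :
    ((l.map Fin.castSucc ++ Fin.last n :: r.map Fin.castSucc : List (Fin (n + 1))) : Multiset _)
      = Fin.last n ::ₘ ((l ++ r).map Fin.castSucc : List _) := by
  rw [Multiset.cons_coe, Multiset.coe_eq_coe, List.map_append]
  exact List.perm_middle

theorem addLeaf_multiset (h : T.children i = l ++ r) :
    T.root.castSucc ::ₘ ∑ v, (T.addLeafChildren i l r v : Multiset (Fin (n + 1)))
      = Finset.univ.val := by
  rw [Fin.sum_univ_castSucc, addLeafChildren_last, univ_val_succ, ← T.root_cons_sum_children,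
    Multiset.map_cons, Multiset.cons_swap, ← sum_update_cons_last _ i, Multiset.coe_nil, add_zero]
  congr 1
  refine Finset.sum_congr rfl fun v _ => ?_
  by_cases hv : v = i
  · rw [hv, addLeafChildren_self, Function.update_self, coe_append_last_cons, h]
  · rw [addLeafChildren_of_ne _ hv, Function.update_of_ne hv]

theorem addLeaf_reachable (h : T.children i = l ++ r) (v : Fin (n + 1)) :
    Relation.ReflTransGen (fun a b => b ∈ T.addLeafChildren i l r a) T.root.castSucc v := by
  have key : ∀ v : Fin n, Relation.ReflTransGen (fun a b => b ∈ T.addLeafChildren i l r a)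
      T.root.castSucc v.castSucc := by
    intro v
    induction T.reachable v with
    | refl => exact .refl
    | @tail a b _ hab ih =>
      refine ih.tail ?_
      by_cases ha : a = i
      · subst ha
        rw [h] at hab
        rw [addLeafChildren_self]
        rcases List.mem_append.1 hab with hb | hb
        · exact List.mem_append_left _ (List.mem_map_of_mem hb)
        · exact List.mem_append_right _ (List.mem_cons_of_mem _ (List.mem_map_of_mem hb))
      · rw [addLeafChildren_of_ne _ ha]
        exact List.mem_map_of_mem hab
  refine Fin.lastCases ((key i).tail ?_) key v
  rw [addLeafChildren_self]
  simp

/-- The tree in which a new largest leaf has been inserted among the children of `i`. -/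
def addLeaf (i : Fin n) (l r : List (Fin n)) (h : T.children i = l ++ r) :
    PlaneTree (Fin (n + 1)) :=
  ofMultiset T.root.castSucc (T.addLeafChildren i l r) (T.addLeaf_multiset h)
    (T.addLeaf_reachable h)

theorem addLeaf_children_last {h} : (T.addLeaf i l r h).children (Fin.last n) = [] :=
  T.addLeafChildren_last

theorem addLeaf_children_self {h} : (T.addLeaf i l r h).children i.castSucc
    = l.map Fin.castSucc ++ Fin.last n :: r.map Fin.castSucc :=
  T.addLeafChildren_self

theorem addLeaf_children_of_ne {h} {v : Fin n} (hv : v ≠ i) :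
    (T.addLeaf i l r h).children v.castSucc = (T.children v).map Fin.castSucc :=
  T.addLeafChildren_of_ne hv

/-- The position of the last vertex in the child lists reveals `i`, `l` and `r`; erasing it reveals
the tree. -/
theorem addLeaf_injective {T₁ T₂ : PlaneTree (Fin n)} {i₁ i₂ : Fin n}
    {l₁ r₁ l₂ r₂ : List (Fin n)} {h₁ h₂}
    (h : T₁.addLeaf i₁ l₁ r₁ h₁ = T₂.addLeaf i₂ l₂ r₂ h₂) :
    T₁ = T₂ ∧ i₁ = i₂ ∧ l₁ = l₂ := by
  have hmap := List.map_injective_iff.2 (Fin.castSucc_injective n)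
  have hi : i₁ = i₂ := by
    by_contra hne
    have h1 := T₁.addLeaf_children_self (h := h₁)
    rw [h, addLeaf_children_of_ne _ hne] at h1
    refine last_notMem_map_castSucc (T₂.children i₁) ?_
    rw [h1]
    simp
  subst hi
  have h1 := T₁.addLeaf_children_self (h := h₁)
  rw [h, addLeaf_children_self] at h1
  obtain ⟨hl, hr⟩ := (List.append_cons_inj_of_notMem (last_notMem_map_castSucc _)
    (last_notMem_map_castSucc _)).1 h1
  refine ⟨PlaneTree.ext (Fin.castSucc_injective n (congrArg root h)) (funext fun v => ?_), rfl,
    (hmap hl).symm⟩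
  by_cases hv : v = i₁
  · rw [hv, h₁, h₂, hmap hl, hmap hr.2]
  · have := T₁.addLeaf_children_of_ne (h := h₁) hv
    rw [h, addLeaf_children_of_ne _ hv] at this
    exact (hmap this).symm

theorem minDesc_addLeaf (h : T.children i = l ++ r) :
    (∀ v : Fin n, (T.addLeaf i l r h).minDesc v.castSucc = T.minDesc v) ∧
      (T.addLeaf i l r h).minDesc (Fin.last n) = n := by
  let f : Fin (n + 1) → ℕ := Fin.snoc (α := fun _ => ℕ) T.minDesc n
  have f_cast : ∀ v : Fin n, f v.castSucc = T.minDesc v := fun v => Fin.snoc_castSucc ..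
  have f_last : f (Fin.last n) = n := Fin.snoc_last ..
  have key := (T.addLeaf i l r h).minDesc_unique (f := f) ?_ ?_ ?_
  · exact ⟨fun v => (key _).trans (f_cast v), (key _).trans f_last⟩
  · refine Fin.lastCases ?_ fun v => ?_
    · rw [f_last, Fin.val_last]
    · rw [f_cast]
      exact T.minDesc_le v
  · refine Fin.lastCases ?_ fun v => ?_
    · rw [addLeaf_children_last]
      simp
    · by_cases hv : v = i
      · rw [hv, addLeaf_children_self]
        intro c hc
        rw [f_cast]
        have hc' : c = Fin.last n ∨ c ∈ (T.children i).map Fin.castSucc := by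
          rw [h, List.map_append]
          simpa [or_left_comm] using hc
        rcases hc' with rfl | hc'
        · rw [f_last]
          exact (T.minDesc_lt i).le
        · obtain ⟨d, hd, rfl⟩ := List.mem_map.1 hc'
          rw [f_cast]
          exact T.minDesc_le_child hd
      · rw [addLeaf_children_of_ne _ hv, f_cast, List.forall_mem_map]
        intro c hc
        rw [f_cast]
        exact T.minDesc_le_child hc
  · refine Fin.lastCases (Or.inl f_last) fun v => ?_
    rw [f_cast]
    refine (T.minDesc_eq_or v).imp id ?_
    rintro ⟨c, hc, h'⟩
    refine ⟨c.castSucc, ?_, by rw [f_cast, h']⟩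
    by_cases hv : v = i
    · subst hv
      rw [h] at hc
      rw [addLeaf_children_self]
      rcases List.mem_append.1 hc with hb | hb
      · exact List.mem_append_left _ (List.mem_map_of_mem hb)
      · exact List.mem_append_right _ (List.mem_cons_of_mem _ (List.mem_map_of_mem hb))
    · rw [addLeaf_children_of_ne _ hv]
      exact List.mem_map_of_mem hc

theorem exists_addLeaf_eq [NeZero n] (S : PlaneTree (Fin (n + 1)))
    (hS : S.children (Fin.last n) = []) :
    ∃ (T : PlaneTree (Fin n)) (i : Fin n) (l r : List (Fin n)) (h : T.children i = l ++ r),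
      T.addLeaf i l r h = S := by
  -- As `n > 0` there is another vertex, which a childless root could not reach.
  have hroot : S.root ≠ Fin.last n := by
    intro hr
    rcases Relation.ReflTransGen.cases_head (S.reachable (Fin.castSucc 0)) with h | ⟨c, hc, -⟩
    · exact Fin.castSucc_ne_last _ (h.symm.trans hr)
    · rw [hr, hS] at hc
      simp at hc
  obtain ⟨p, hp⟩ := S.exists_parent hroot.symm
  have hp' : p ≠ Fin.last n := fun h => by simp [h, hS] at hp
  obtain ⟨i, rfl⟩ := Fin.exists_castSucc_eq.2 hp'
  obtain ⟨ρ, hρ⟩ := Fin.exists_castSucc_eq.2 hroot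
  obtain ⟨l', r', hlr⟩ := List.append_of_mem hp
  have hnd := S.nodup_children i.castSucc
  rw [hlr, List.nodup_middle, List.nodup_cons, List.mem_append, not_or] at hnd
  obtain ⟨l, rfl⟩ := exists_map_castSucc hnd.1.1
  obtain ⟨r, rfl⟩ := exists_map_castSucc hnd.1.2
  have hex : ∀ v : Fin n, ∃ m : List (Fin n),
      (v ≠ i → m.map Fin.castSucc = S.children v.castSucc) ∧ (v = i → m = l ++ r) := by
    intro v
    by_cases hv : v = i
    · exact ⟨l ++ r, fun h => absurd hv h, fun _ => rfl⟩
    · obtain ⟨m, hm⟩ := exists_map_castSucc (l := S.children v.castSucc) fun h =>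
        hv (Fin.castSucc_injective n (S.parent_unique _ _ _ h hp))
      exact ⟨m, fun _ => hm, fun h => absurd h hv⟩
  choose ch ch_ne ch_eq using hex
  have ch_self := ch_eq i rfl
  have hmult : ρ ::ₘ ∑ v, (ch v : Multiset (Fin n)) = Finset.univ.val := by
    apply Multiset.map_injective (Fin.castSucc_injective n)
    have h1 := S.root_cons_sum_children
    rw [univ_val_succ, Fin.sum_univ_castSucc, hS, ← hρ, Multiset.coe_nil, add_zero] at h1
    rw [← Multiset.cons_inj_right (Fin.last n), ← h1, Multiset.map_cons, Multiset.cons_swap]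
    congr 1
    rw [← sum_update_cons_last _ i]
    refine Finset.sum_congr rfl fun v _ => ?_
    by_cases hv : v = i
    · rw [hv, Function.update_self, hlr, coe_append_last_cons, ch_self]
    · rw [Function.update_of_ne hv, ch_ne v hv]
  have hreach : ∀ v, Relation.ReflTransGen (fun a b => b ∈ ch a) ρ v := by
    have key : ∀ w, ∀ v : Fin n, v.castSucc = w →
        Relation.ReflTransGen (fun a b => b ∈ ch a) ρ v := by
      intro w
      induction S.reachable w with
      | refl =>
        intro v hv
        rw [Fin.castSucc_injective n (hv.trans hρ.symm)]
      | @tail b c _ hbc ih =>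
        rintro v rfl
        have hb : b ≠ Fin.last n := fun h => by simp [h, hS] at hbc
        obtain ⟨a, rfl⟩ := Fin.exists_castSucc_eq.2 hb
        refine (ih a rfl).tail ?_
        by_cases ha : a = i
        · subst ha
          rw [hlr] at hbc
          rw [ch_self]
          simpa [Fin.castSucc_ne_last] using hbc
        · rw [← ch_ne a ha] at hbc
          simpa using hbc
    exact fun v => key _ v rfl
  obtain ⟨T, hTρ, hTch⟩ : ∃ T : PlaneTree (Fin n), T.root = ρ ∧ T.children = ch :=
    ⟨ofMultiset ρ ch hmult hreach, rfl, rfl⟩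
  have hT : T.children i = l ++ r := by rw [hTch, ch_self]
  refine ⟨T, i, l, r, hT, PlaneTree.ext ?_ (funext fun v => ?_)⟩
  · exact (congrArg Fin.castSucc hTρ).trans hρ
  · induction v using Fin.lastCases with
    | last => rw [addLeaf_children_last, hS]
    | cast v =>
      by_cases hv : v = i
      · rw [hv, addLeaf_children_self, hlr]
      · rw [addLeaf_children_of_ne _ hv, hTch]
        exact ch_ne v hv

end AddLeaf

end PlaneTree

/-! ### Splitting a list of β-values at an improper edge -/

/-- Here `A`, `c`, `B` are the β-values of the brothers left of `j`, of `j`, and of those right of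
`j`, while `g` is the new β of `i`. Since `c` is the minimum of every tail after `A`, only the tails
contribute to the change: `g` before `c` is one new elder entry. -/
theorem elderCount_split_elder (A : List ℕ) {B : List ℕ} {c g : ℕ} (hg : c < g)
    (hB : ∀ k ∈ B, c ≤ k) :
    elderCount (A ++ [g, c]) + elderCount B = elderCount (A ++ c :: B) + 1 := by
  have hc : ¬ ∃ k ∈ B, k < c := fun ⟨k, hk, hkc⟩ => (hB k hk).not_gt hkc
  rw [elderCount_append (m := [g, c]) (c := c) A (by simp) (by simp [hg.le]),
    elderCount_append (m := c :: B) (c := c) A (by simp) (by simpa using hB)]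
  simp only [elderCount, if_neg hc]
  simp [hg]
  ring

theorem elderCount_split_younger (A : List ℕ) {B : List ℕ} {c g : ℕ} (hg : c < g)
    (hB : ∀ k ∈ B, c ≤ k) :
    elderCount (A ++ [c, g]) + elderCount B = elderCount (A ++ c :: B) := by
  have hc : ¬ ∃ k ∈ B, k < c := fun ⟨k, hk, hkc⟩ => (hB k hk).not_gt hkc
  rw [elderCount_append (m := [c, g]) (c := c) A (by simp) (by simp [hg.le]),
    elderCount_append (m := c :: B) (c := c) A (by simp) (by simpa using hB)]
  simp only [elderCount, if_neg hc]
  simp [hg.le]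

/-- The threshold for `A` rises from `i` to `n` without effect, because `c` is below both; `g` is
elder and so not counted. -/
theorem improperCount_split_elder (A : List ℕ) {B : List ℕ} {c g i n : ℕ} (hg : c < g)
    (hB : ∀ k ∈ B, c ≤ k) (hi : c ≤ i) (hn : c ≤ n) :
    improperCount n (A ++ [g, c]) + improperCount i B = improperCount i (A ++ c :: B) := by
  have h1 := improperCount_append (m := [g, c]) (c := c) A (by simp) (by simp [hg.le]) hn
  have h2 := improperCount_append (m := c :: B) (c := c) A (by simp) (by simpa using hB) hi
  rw [improperCount_append_singleton A hn hi] at h1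
  simp only [improperCount, hi, true_and, if_pos hB] at h2
  simp [improperCount, hg.not_ge, hn] at h1
  omega

/-- Now `g` comes last and is at most `n`, so it is counted, which gives the extra 1. -/
theorem improperCount_split_younger (A : List ℕ) {B : List ℕ} {c g i n : ℕ} (hg : c < g)
    (hB : ∀ k ∈ B, c ≤ k) (hi : c ≤ i) (hn : g ≤ n) :
    improperCount n (A ++ [c, g]) + improperCount i B = improperCount i (A ++ c :: B) + 1 := by
  have hc := hg.le.trans hn
  have h1 := improperCount_append (m := [c, g]) (c := c) A (by simp) (by simp [hg.le]) hc
  have h2 := improperCount_append (m := c :: B) (c := c) A (by simp) (by simpa using hB) hi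
  rw [improperCount_append_singleton A hc hi] at h1
  simp only [improperCount, hi, true_and, if_pos hB] at h2
  simp [improperCount, hg.le, hn, hc] at h1
  omega

/-! ### Effect of the constructions on the statistics -/

namespace PlaneTree

variable {n : ℕ}

theorem sum_apply_update {ι α : Type*} [Fintype ι] [DecidableEq ι] (f : ι → α → ℕ) (g : ι → α)
    (i : ι) (b : α) :
    ∑ v, f v (Function.update g i b v) + f i (g i) = ∑ v, f v (g v) + f i b := by
  rw [← sum_update_add (fun v => f v (g v)) i (f i b)]
  congr 1
  exact Finset.sum_congr rfl fun v _ => Function.apply_update f g i b v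

section AddLeafStat

variable (T : PlaneTree (Fin n)) {i : Fin n} {l r : List (Fin n)}

theorem betaList_addLeaf (h : T.children i = l ++ r) (v : Fin n) :
    (T.addLeaf i l r h).betaList v.castSucc
      = Function.update T.betaList i (l.map T.minDesc ++ n :: r.map T.minDesc) v := by
  obtain ⟨h1, h2⟩ := T.minDesc_addLeaf h
  have h3 : (T.addLeaf i l r h).minDesc ∘ Fin.castSucc = T.minDesc := funext h1
  by_cases hv : v = i
  · rw [hv, betaList, addLeaf_children_self, Function.update_self, List.map_append, List.map_cons,
      h2, List.map_map, List.map_map, h3]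
  · rw [betaList, addLeaf_children_of_ne _ hv, Function.update_of_ne hv, List.map_map, h3]
    rfl

theorem betaList_addLeaf_last (h : T.children i = l ++ r) :
    (T.addLeaf i l r h).betaList (Fin.last n) = [] := by
  rw [betaList, addLeaf_children_last, List.map_nil]

theorem betaList_eq_append (h : T.children i = l ++ r) :
    T.betaList i = l.map T.minDesc ++ r.map T.minDesc := by
  rw [betaList, h, List.map_append]

theorem forall_mem_map_minDesc_lt (l : List (Fin n)) : ∀ k ∈ l.map T.minDesc, k < n := by
  simp [T.minDesc_lt]

theorem eld_addLeaf (h : T.children i = l ++ r) :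
    (T.addLeaf i l r h).eld = T.eld + if r = [] then 0 else 1 := by
  have h1 := sum_apply_update (fun _ => elderCount) T.betaList i
    (l.map T.minDesc ++ n :: r.map T.minDesc)
  have h2 := elderCount_insert_max (l.map T.minDesc) (r.map T.minDesc)
    (T.forall_mem_map_minDesc_lt l) (T.forall_mem_map_minDesc_lt r)
  rw [eld_eq, eld_eq, Fin.sum_univ_castSucc, betaList_addLeaf_last]
  simp only [betaList_addLeaf, elderCount]
  rw [← T.betaList_eq_append h] at h2
  simp only [List.map_eq_nil_iff] at h2
  omega

theorem imp_addLeaf (h : T.children i = l ++ r) : (T.addLeaf i l r h).imp = T.imp := by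
  have h1 := sum_apply_update (fun v : Fin n => improperCount v) T.betaList i
    (l.map T.minDesc ++ n :: r.map T.minDesc)
  have h2 := improperCount_insert_max (l.map T.minDesc) (r.map T.minDesc)
    (T.forall_mem_map_minDesc_lt l) i.2
  rw [imp_eq, imp_eq, Fin.sum_univ_castSucc, betaList_addLeaf_last]
  simp only [betaList_addLeaf, improperCount, Fin.val_castSucc]
  rw [← T.betaList_eq_append h] at h2
  omega

theorem young_addLeaf (h : T.children i = l ++ r) (v : Fin n) :
    (T.addLeaf i l r h).young v.castSucc
      = T.young v + if v = i ∧ r = [] then 1 else 0 := by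
  rw [young_eq, young_eq, betaList_addLeaf]
  by_cases hv : v = i
  · rw [hv, Function.update_self, youngerCount_insert_max _ _ (T.forall_mem_map_minDesc_lt l)
      (T.forall_mem_map_minDesc_lt r), ← T.betaList_eq_append h]
    simp
  · simp [hv]

end AddLeafStat

section GraftStat

variable (T : PlaneTree (Fin n)) {i j : Fin n} {l N r : List (Fin n)}

theorem notMem_kept (hi : i ∈ N) (h : (N ++ r).Perm (i :: T.children i)) : i ∉ r := by
  have hnd : (N ++ r).Nodup :=
    h.nodup_iff.2 (List.nodup_cons.2 ⟨T.notMem_children_self i, T.nodup_children i⟩)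
  exact fun hr => List.disjoint_of_nodup_append hnd hi hr

theorem map_minDesc_graft (hi : i ∈ N) (h : (N ++ r).Perm (i :: T.children i))
    {m : List (Fin n)} (hm : i ∉ m) :
    (m.map Fin.castSucc).map (T.graft i N r hi h).minDesc = m.map T.minDesc := by
  rw [List.map_map]
  refine List.map_congr_left fun v hv => ?_
  rw [← (T.minDesc_graft hi h).1 v, substLast_of_ne (ne_of_mem_of_not_mem hv hm)]
  rfl

/-- The vertex replacing `i` inherits its β, so the parent of `i` sees no difference. -/
theorem betaList_graft (hi : i ∈ N) (h : (N ++ r).Perm (i :: T.children i)) (v : Fin n) :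
    (T.graft i N r hi h).betaList v.castSucc
      = Function.update T.betaList i (r.map T.minDesc) v := by
  by_cases hv : v = i
  · rw [hv, betaList, graft_children_self, Function.update_self,
      map_minDesc_graft _ _ _ (T.notMem_kept hi h)]
  · rw [betaList, graft_children_of_ne _ hv, Function.update_of_ne hv, List.map_map]
    exact List.map_congr_left fun v _ => (T.minDesc_graft hi h).1 v

theorem eld_graft (hi : i ∈ N) (h : (N ++ r).Perm (i :: T.children i)) :
    (T.graft i N r hi h).eld + elderCount (T.betaList i) = T.eld + elderCount (r.map T.minDesc)
      + elderCount ((T.graft i N r hi h).betaList (Fin.last n)) := by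
  have h1 := sum_apply_update (fun _ => elderCount) T.betaList i (r.map T.minDesc)
  rw [eld_eq, eld_eq, Fin.sum_univ_castSucc]
  simp only [betaList_graft]
  omega

theorem imp_graft (hi : i ∈ N) (h : (N ++ r).Perm (i :: T.children i)) :
    (T.graft i N r hi h).imp + improperCount i (T.betaList i)
      = T.imp + improperCount i (r.map T.minDesc)
        + improperCount n ((T.graft i N r hi h).betaList (Fin.last n)) := by
  have h1 := sum_apply_update (fun v : Fin n => improperCount v) T.betaList i (r.map T.minDesc)
  rw [imp_eq, imp_eq, Fin.sum_univ_castSucc]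
  simp only [betaList_graft, Fin.val_castSucc, Fin.val_last]
  omega

theorem young_graft (hi : i ∈ N) (h : (N ++ r).Perm (i :: T.children i)) {v : Fin n}
    (hv : v ≠ i) : (T.graft i N r hi h).young v.castSucc = T.young v := by
  rw [young_eq, young_eq, betaList_graft, Function.update_of_ne hv]

/-- The tree in which the new largest vertex has been inserted above the vertex `i`. -/
def insertAbove (i : Fin n) : PlaneTree (Fin (n + 1)) :=
  T.graft i [i] (T.children i) List.mem_cons_self (List.Perm.refl _)

theorem eld_insertAbove : (T.insertAbove i).eld = T.eld := by
  have h := T.eld_graft (N := [i]) (r := T.children i) List.mem_cons_self (List.Perm.refl _)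
  rw [betaList, betaList, graft_children_last] at h
  simp only [List.map_cons, List.map_nil, elderCount, List.not_mem_nil, false_and, exists_false,
    if_false] at h
  change (T.insertAbove i).eld + _ = _ at h
  omega

/-- An only child is younger and its β is below the largest label, so the new edge down to `i` is
improper. -/
theorem imp_insertAbove : (T.insertAbove i).imp = T.imp + 1 := by
  have h := T.imp_graft (N := [i]) (r := T.children i) List.mem_cons_self (List.Perm.refl _)
  have h' := ((T.insertAbove i).minDesc_le i.castSucc).trans i.2.le
  rw [betaList, betaList, graft_children_last] at h
  change (T.insertAbove i).imp + _ = _ + improperCount n [(T.insertAbove i).minDesc _] at h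
  simp only [improperCount, h', List.not_mem_nil, false_imp_iff, implies_true, and_self,
    if_true] at h
  omega

theorem young_insertAbove (v : Fin n) : (T.insertAbove i).young v.castSucc = T.young v := by
  rw [young_eq, young_eq, insertAbove, betaList_graft]
  rw [show (T.children i).map T.minDesc = T.betaList i from rfl, Function.update_eq_self]

theorem perm_elder (h : T.children i = l ++ j :: r) :
    ((l ++ [i, j]) ++ r).Perm (i :: T.children i) := by
  rw [h, List.append_assoc]
  exact List.perm_middle

theorem perm_younger (h : T.children i = l ++ j :: r) :
    ((l ++ [j, i]) ++ r).Perm (i :: T.children i) :=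
  (((List.Perm.swap i j []).append_left l).append_right r).trans (T.perm_elder h)

/-- The tree in which the new largest vertex takes the place of `i`, gets the children of `i` to
the left of `j` and then `i` and `j`, while `i` keeps the children to the right of `j`. -/
def splitElder (i j : Fin n) (l r : List (Fin n)) (h : T.children i = l ++ j :: r) :
    PlaneTree (Fin (n + 1)) :=
  T.graft i (l ++ [i, j]) r (by simp) (T.perm_elder h)

/-- The tree in which the new largest vertex takes the place of `i`, gets the children of `i` to
the left of `j` and then `j` and `i`, while `i` keeps the children to the right of `j`. -/
def splitYounger (i j : Fin n) (l r : List (Fin n)) (h : T.children i = l ++ j :: r) :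
    PlaneTree (Fin (n + 1)) :=
  T.graft i (l ++ [j, i]) r (by simp) (T.perm_younger h)

theorem isImproperEdge_iff (h : T.children i = l ++ j :: r) :
    T.IsImproperEdge i j ↔ T.minDesc j ≤ i ∧ ∀ k ∈ r, T.minDesc j ≤ T.minDesc k := by
  have hj : j ∈ T.children i := by simp [h]
  have hs : ∀ k, [j, k].Sublist (T.children i) ↔ k ∈ r := by
    intro k
    have hnd := T.nodup_children i
    rw [h] at hnd ⊢
    have hjl : j ∉ l := fun hl => List.disjoint_of_nodup_append hnd hl List.mem_cons_self
    clear hnd hj h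
    induction l with
    | nil => exact List.pair_sublist_cons_self
    | cons a l ih =>
      rw [List.cons_append, List.pair_sublist_cons_of_ne (List.ne_of_not_mem_cons hjl)]
      exact ih fun h => hjl (List.mem_cons_of_mem _ h)
  rw [IsImproperEdge, and_iff_right hj, T.isElder_iff hj]
  simp only [hs]
  change ¬ (_ ∨ (i : ℕ) < T.minDesc j) ↔ _
  push Not
  exact and_comm

theorem child_ne (h : T.children i = l ++ j :: r) : i ∉ l ∧ i ≠ j ∧ i ∉ r := by
  have := T.notMem_children_self i
  rw [h] at this
  simpa using this

/-- The β of `i` after grafting is `i` or the β of some member of `r`, and improperness bounds β of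
`j` by all of these. Equality is excluded because `i` and `j` are now siblings. -/
theorem minDesc_lt_of_isImproperEdge (h : T.children i = l ++ j :: r) (hi : i ∈ N)
    (hp : (N ++ r).Perm (i :: T.children i)) (hj : j ∈ N) (hij : T.IsImproperEdge i j) :
    T.minDesc j < (T.graft i N r hi hp).minDesc i.castSucc := by
  obtain ⟨hji, hjr⟩ := (T.isImproperEdge_iff h).1 hij
  obtain ⟨h1, h2, -⟩ := T.minDesc_graft hi hp
  have hne := (T.child_ne h).2.1
  have h1j := h1 j
  rw [substLast_of_ne hne.symm] at h1j
  refine lt_of_le_of_ne ?_ fun heq => ?_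
  · rcases h2 with h2 | ⟨c, hc, h2⟩
    · exact hji.trans h2.ge
    · exact (hjr c hc).trans h2.ge
  · refine hne (Fin.castSucc_injective n ((T.graft i N r hi hp).minDesc_injOn_children
      (p := Fin.last n) ?_ ?_ (heq.symm.trans h1j.symm)))
    · rw [graft_children_last]
      exact List.mem_map_of_mem hi
    · rw [graft_children_last]
      exact List.mem_map_of_mem hj

theorem minDesc_graft_of_ne (hi : i ∈ N) (hp : (N ++ r).Perm (i :: T.children i)) {v : Fin n}
    (hv : v ≠ i) : (T.graft i N r hi hp).minDesc v.castSucc = T.minDesc v := by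
  rw [← (T.minDesc_graft hi hp).1 v, substLast_of_ne hv]

/-- The converse comparison, needed for surjectivity: the new β of `i` lies below `i` and below
every β in `r`, so whatever lies below it witnesses improperness. -/
theorem isImproperEdge_of_minDesc_le (h : T.children i = l ++ j :: r) (hi : i ∈ N)
    (hp : (N ++ r).Perm (i :: T.children i))
    (hij : (T.graft i N r hi hp).minDesc j.castSucc
      ≤ (T.graft i N r hi hp).minDesc i.castSucc) : T.IsImproperEdge i j := by
  obtain ⟨-, -, h3, h4⟩ := T.minDesc_graft hi hp
  rw [T.minDesc_graft_of_ne hi hp (T.child_ne h).2.1.symm] at hij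
  exact (T.isImproperEdge_iff h).2 ⟨hij.trans h3, fun k hk => hij.trans (h4 k hk)⟩

/-- After a split, β of `j` is strictly below that of `i`, hence below `i`, so `i` is not the
smallest label. Splits therefore leave the exponent of x alone. -/
theorem ne_zero_of_isImproperEdge [NeZero n] (h : T.children i = l ++ j :: r)
    (hij : T.IsImproperEdge i j) : (0 : Fin n) ≠ i := by
  rintro rfl
  have h1 := T.minDesc_lt_of_isImproperEdge h (by simp) (T.perm_elder h) (by simp) hij
  have h2 := (T.minDesc_graft (i := 0) (N := l ++ [0, j]) (by simp) (T.perm_elder h)).2.2.1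
  have h3 : ((0 : Fin n) : ℕ) = 0 := rfl
  omega

theorem betaList_eq_append_cons (h : T.children i = l ++ j :: r) :
    T.betaList i = l.map T.minDesc ++ T.minDesc j :: r.map T.minDesc := by
  rw [betaList, h, List.map_append, List.map_cons]

theorem betaList_splitElder_last (h : T.children i = l ++ j :: r) :
    (T.splitElder i j l r h).betaList (Fin.last n)
      = l.map T.minDesc ++ [(T.splitElder i j l r h).minDesc i.castSucc, T.minDesc j] := by
  obtain ⟨hl, hne, -⟩ := T.child_ne h
  rw [betaList, splitElder, graft_children_last, List.map_append, List.map_append,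
    map_minDesc_graft _ _ _ hl, List.map_cons, List.map_cons, List.map_cons, List.map_cons,
    minDesc_graft_of_ne _ _ _ hne.symm]
  rfl

theorem betaList_splitYounger_last (h : T.children i = l ++ j :: r) :
    (T.splitYounger i j l r h).betaList (Fin.last n)
      = l.map T.minDesc ++ [T.minDesc j, (T.splitYounger i j l r h).minDesc i.castSucc] := by
  obtain ⟨hl, hne, -⟩ := T.child_ne h
  rw [betaList, splitYounger, graft_children_last, List.map_append, List.map_append,
    map_minDesc_graft _ _ _ hl, List.map_cons, List.map_cons, List.map_cons, List.map_cons,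
    minDesc_graft_of_ne _ _ _ hne.symm]
  rfl

theorem eld_splitElder (h : T.children i = l ++ j :: r) (hij : T.IsImproperEdge i j) :
    (T.splitElder i j l r h).eld = T.eld + 1 := by
  obtain ⟨hji, hjr⟩ := (T.isImproperEdge_iff h).1 hij
  have h1 : (T.splitElder i j l r h).eld + _ = _ := T.eld_graft (by simp) (T.perm_elder h)
  have h2 : _ < (T.splitElder i j l r h).minDesc _ :=
    T.minDesc_lt_of_isImproperEdge h (by simp) (T.perm_elder h) (by simp) hij
  change _ = _ + elderCount ((T.splitElder i j l r h).betaList _) at h1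
  rw [T.betaList_splitElder_last h, T.betaList_eq_append_cons h] at h1
  have h3 := elderCount_split_elder (l.map T.minDesc) h2 (List.forall_mem_map.2 hjr)
  omega

theorem eld_splitYounger (h : T.children i = l ++ j :: r) (hij : T.IsImproperEdge i j) :
    (T.splitYounger i j l r h).eld = T.eld := by
  obtain ⟨hji, hjr⟩ := (T.isImproperEdge_iff h).1 hij
  have h1 : (T.splitYounger i j l r h).eld + _ = _ := T.eld_graft (by simp) (T.perm_younger h)
  have h2 : _ < (T.splitYounger i j l r h).minDesc _ :=
    T.minDesc_lt_of_isImproperEdge h (by simp) (T.perm_younger h) (by simp) hij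
  change _ = _ + elderCount ((T.splitYounger i j l r h).betaList _) at h1
  rw [T.betaList_splitYounger_last h, T.betaList_eq_append_cons h] at h1
  have h3 := elderCount_split_younger (l.map T.minDesc) h2 (List.forall_mem_map.2 hjr)
  omega

theorem imp_splitElder (h : T.children i = l ++ j :: r) (hij : T.IsImproperEdge i j) :
    (T.splitElder i j l r h).imp = T.imp := by
  obtain ⟨hji, hjr⟩ := (T.isImproperEdge_iff h).1 hij
  have h1 : (T.splitElder i j l r h).imp + _ = _ := T.imp_graft (by simp) (T.perm_elder h)
  have h2 : _ < (T.splitElder i j l r h).minDesc _ :=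
    T.minDesc_lt_of_isImproperEdge h (by simp) (T.perm_elder h) (by simp) hij
  change _ = _ + improperCount n ((T.splitElder i j l r h).betaList _) at h1
  rw [T.betaList_splitElder_last h, T.betaList_eq_append_cons h] at h1
  have h3 := improperCount_split_elder (l.map T.minDesc) h2 (List.forall_mem_map.2 hjr) hji
    (T.minDesc_lt j).le
  omega

theorem imp_splitYounger (h : T.children i = l ++ j :: r) (hij : T.IsImproperEdge i j) :
    (T.splitYounger i j l r h).imp = T.imp + 1 := by
  obtain ⟨hji, hjr⟩ := (T.isImproperEdge_iff h).1 hij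
  have h1 : (T.splitYounger i j l r h).imp + _ = _ := T.imp_graft (by simp) (T.perm_younger h)
  have h2 : _ < (T.splitYounger i j l r h).minDesc _ :=
    T.minDesc_lt_of_isImproperEdge h (by simp) (T.perm_younger h) (by simp) hij
  change _ = _ + improperCount n ((T.splitYounger i j l r h).betaList _) at h1
  rw [T.betaList_splitYounger_last h, T.betaList_eq_append_cons h] at h1
  have h3 := improperCount_split_younger (l.map T.minDesc) h2 (List.forall_mem_map.2 hjr) hji
    (((T.splitYounger i j l r h).minDesc_le _).trans i.2.le)
  omega

end GraftStat

end PlaneTree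

/-! ### Weights -/

namespace PlaneTree

variable {n : ℕ} [NeZero n] {R : Type*} [CommRing R] (x t y : R)

/-- The weight `x ^ young_T(v) * t ^ eld(T) * y ^ imp(T)` of a plane tree, where `v` is the vertex
with the smallest label. -/
noncomputable def weight (T : PlaneTree (Fin n)) : R := x ^ T.young 0 * t ^ T.eld * y ^ T.imp

section Weight

variable (T : PlaneTree (Fin n)) {i j : Fin n} {l r : List (Fin n)}

theorem weight_addLeaf (h : T.children i = l ++ r) :
    (T.addLeaf i l r h).weight x t y
      = T.weight x t y * if r = [] then (if i = 0 then x else 1) else t := by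
  have h0 := T.young_addLeaf h 0
  rw [Fin.castSucc_zero'] at h0
  rw [weight, weight, h0, eld_addLeaf, imp_addLeaf]
  simp only [eq_comm (a := (0 : Fin n))]
  split_ifs <;> simp_all [pow_succ] <;> ring

theorem weight_insertAbove : (T.insertAbove i).weight x t y = T.weight x t y * y := by
  have h0 := T.young_insertAbove (i := i) 0
  rw [Fin.castSucc_zero'] at h0
  rw [weight, weight, h0, eld_insertAbove, imp_insertAbove]
  ring

theorem weight_splitElder (h : T.children i = l ++ j :: r) (hij : T.IsImproperEdge i j) :
    (T.splitElder i j l r h).weight x t y = T.weight x t y * t := by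
  have h0 : (T.splitElder i j l r h).young _ = _ :=
    T.young_graft (by simp) (T.perm_elder h) (T.ne_zero_of_isImproperEdge h hij)
  rw [Fin.castSucc_zero'] at h0
  rw [weight, weight, h0, eld_splitElder _ h hij, imp_splitElder _ h hij]
  ring

theorem weight_splitYounger (h : T.children i = l ++ j :: r) (hij : T.IsImproperEdge i j) :
    (T.splitYounger i j l r h).weight x t y = T.weight x t y * y := by
  have h0 : (T.splitYounger i j l r h).young _ = _ :=
    T.young_graft (by simp) (T.perm_younger h) (T.ne_zero_of_isImproperEdge h hij)
  rw [Fin.castSucc_zero'] at h0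
  rw [weight, weight, h0, eld_splitYounger _ h hij, imp_splitYounger _ h hij]
  ring

end Weight

/-! ### Splits correspond to trees whose largest vertex has at least two children -/

section SplitBijection

variable {n : ℕ}

open Classical in
/-- The improper edges of a plane tree. -/
noncomputable def improperEdges (T : PlaneTree (Fin n)) : Finset (Fin n × Fin n) :=
  Finset.univ.filter fun e : Fin n × Fin n => T.IsImproperEdge e.1 e.2

theorem mem_improperEdges {T : PlaneTree (Fin n)} {e : Fin n × Fin n} :
    e ∈ T.improperEdges ↔ T.IsImproperEdge e.1 e.2 := by
  simp [improperEdges]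

theorem exists_split {T : PlaneTree (Fin n)} {e : Fin n × Fin n} (he : e ∈ T.improperEdges) :
    ∃ l r, T.children e.1 = l ++ e.2 :: r :=
  List.append_of_mem (mem_improperEdges.1 he).1

/-- Makes the choice of `l` and `r` for a given edge harmless. -/
theorem split_unique (T : PlaneTree (Fin n)) {i j : Fin n} {l₁ l₂ r₁ r₂ : List (Fin n)}
    (h₁ : T.children i = l₁ ++ j :: r₁) (h₂ : T.children i = l₂ ++ j :: r₂) :
    l₁ = l₂ ∧ r₁ = r₂ := by
  have hnd := T.nodup_children i
  have hnd' := hnd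
  rw [h₁, List.nodup_middle, List.nodup_cons, List.mem_append, not_or] at hnd
  rw [h₂, List.nodup_middle, List.nodup_cons, List.mem_append, not_or] at hnd'
  obtain ⟨h, -, h'⟩ := (List.append_cons_inj_of_notMem hnd'.1.1 hnd'.1.2).1 (h₂.symm.trans h₁)
  exact ⟨h.symm, h'.symm⟩

/-- The children of the last vertex reveal `l`, `i` and `j`, those of `i` reveal `r`; together they
restore the child list of `i`, and `graft_ext` does the rest. -/
theorem splitElder_injective {T₁ T₂ : PlaneTree (Fin n)} {i₁ i₂ j₁ j₂ : Fin n}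
    {l₁ l₂ r₁ r₂ : List (Fin n)} {h₁ h₂}
    (h : T₁.splitElder i₁ j₁ l₁ r₁ h₁ = T₂.splitElder i₂ j₂ l₂ r₂ h₂) :
    T₁ = T₂ ∧ i₁ = i₂ ∧ j₁ = j₂ := by
  obtain ⟨rfl, h'⟩ := List.append_inj' (graft_new_eq h) rfl
  simp only [List.cons.injEq, and_true] at h'
  obtain ⟨rfl, rfl⟩ := h'
  obtain rfl := graft_kept_eq h
  exact ⟨graft_ext h (h₁.trans h₂.symm), rfl, rfl⟩

theorem splitYounger_injective {T₁ T₂ : PlaneTree (Fin n)} {i₁ i₂ j₁ j₂ : Fin n}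
    {l₁ l₂ r₁ r₂ : List (Fin n)} {h₁ h₂}
    (h : T₁.splitYounger i₁ j₁ l₁ r₁ h₁ = T₂.splitYounger i₂ j₂ l₂ r₂ h₂) :
    T₁ = T₂ ∧ i₁ = i₂ ∧ j₁ = j₂ := by
  obtain ⟨rfl, h'⟩ := List.append_inj' (graft_new_eq h) rfl
  simp only [List.cons.injEq, and_true] at h'
  obtain ⟨rfl, rfl⟩ := h'
  obtain rfl := graft_kept_eq h
  exact ⟨graft_ext h (h₁.trans h₂.symm), rfl, rfl⟩

/-- By acyclicity the last vertex is not a child of its own child `a`. -/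
theorem exists_kept (S : PlaneTree (Fin (n + 1))) {a : Fin n} {N : List (Fin n)}
    (hN : S.children (Fin.last n) = N.map Fin.castSucc) (ha : a ∈ N) :
    ∃ r : List (Fin n), r.map Fin.castSucc = S.children a.castSucc :=
  exists_map_castSucc fun h => S.mem_children_trans_ne (Fin.last n)
    (.tail (.single (hN ▸ List.mem_map_of_mem ha)) h)

theorem exists_last_children (S : PlaneTree (Fin (n + 1)))
    (hS : 2 ≤ (S.children (Fin.last n)).length) :
    ∃ (l : List (Fin n)) (a b : Fin n),
      S.children (Fin.last n) = (l ++ [a, b]).map Fin.castSucc := by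
  obtain ⟨N, hN⟩ := exists_map_castSucc (S.notMem_children_self (Fin.last n))
  rw [← hN, List.length_map] at hS
  rcases List.eq_nil_or_concat N with rfl | ⟨N', b, rfl⟩
  · simp at hS
  · rcases List.eq_nil_or_concat N' with rfl | ⟨l, a, rfl⟩
    · simp at hS
    · exact ⟨l, a, b, by simpa using hN.symm⟩

/-- The new largest vertex has at least two children, and the last two of them form a descent. -/
def EndsInDescent (S : PlaneTree (Fin (n + 1))) : Prop :=
  ∃ l a b, S.children (Fin.last n) = l ++ [a, b] ∧ S.minDesc b < S.minDesc a

theorem endsInDescent_iff {S : PlaneTree (Fin (n + 1))} {l : List (Fin n)} {a b : Fin n}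
    (h : S.children (Fin.last n) = (l ++ [a, b]).map Fin.castSucc) :
    S.EndsInDescent ↔ S.minDesc b.castSucc < S.minDesc a.castSucc := by
  rw [List.map_append] at h
  refine ⟨?_, fun h' => ⟨_, _, _, h, h'⟩⟩
  rintro ⟨l', a', b', h', hlt⟩
  obtain ⟨-, h2⟩ := List.append_inj' (h.symm.trans h') rfl
  simp only [List.map_cons, List.map_nil, List.cons.injEq, and_true] at h2
  rwa [h2.1, h2.2]

theorem endsInDescent_splitElder {T : PlaneTree (Fin n)} {i j : Fin n} {l r : List (Fin n)}
    (h : T.children i = l ++ j :: r) :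
    (T.splitElder i j l r h).EndsInDescent ↔ T.IsImproperEdge i j := by
  have hS : (T.splitElder i j l r h).children (Fin.last n) = _ := T.graft_children_last
  rw [endsInDescent_iff hS]
  exact ⟨fun hlt => T.isImproperEdge_of_minDesc_le h (by simp) (T.perm_elder h) hlt.le,
    fun hij => (T.minDesc_graft_of_ne (by simp) (T.perm_elder h) (T.child_ne h).2.1.symm).trans_lt
      (T.minDesc_lt_of_isImproperEdge h (by simp) (T.perm_elder h) (by simp) hij)⟩

theorem not_endsInDescent_splitYounger {T : PlaneTree (Fin n)} {i j : Fin n}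
    {l r : List (Fin n)} (h : T.children i = l ++ j :: r) :
    ¬ (T.splitYounger i j l r h).EndsInDescent ↔ T.IsImproperEdge i j := by
  have hS : (T.splitYounger i j l r h).children (Fin.last n) = _ := T.graft_children_last
  rw [endsInDescent_iff hS, not_lt]
  exact ⟨fun hle => T.isImproperEdge_of_minDesc_le h (by simp) (T.perm_younger h) hle,
    fun hij =>
      ((T.minDesc_graft_of_ne (by simp) (T.perm_younger h) (T.child_ne h).2.1.symm).trans_lt
        (T.minDesc_lt_of_isImproperEdge h (by simp) (T.perm_younger h) (by simp) hij)).le⟩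

end SplitBijection

/-! ### The recurrence for the weight sums -/

section Sums

open Classical in
theorem sum_leaf :
    ∑ S : PlaneTree (Fin (n + 1)) with (S.children (Fin.last n)).length = 0, S.weight x t y
      = ∑ T : PlaneTree (Fin n), T.weight x t y * (x + (n - 1) + (n - 1) * t) := by
  -- Expands the factor as a sum over insertion slots: vertex `i` offers one slot more than it has
  -- children, and the slot is rightmost exactly when nothing is dropped into the right part.
  have h1 : ∀ T : PlaneTree (Fin n), T.weight x t y * (x + (n - 1) + (n - 1) * t)
      = ∑ a ∈ Finset.univ.sigma fun i => Finset.range ((T.children i).length + 1),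
        T.weight x t y
          * if (T.children a.1).drop a.2 = [] then (if a.1 = 0 then x else 1) else t := by
    intro T
    have hlen : ((∑ v, (T.children v).length : ℕ) : R) = n - 1 := by
      have := T.sum_length_children
      rw [Fintype.card_fin] at this
      rw [eq_sub_iff_add_eq]
      exact_mod_cast congrArg (Nat.cast (R := R)) this
    have hi : ∀ i : Fin n, (∑ p ∈ Finset.range ((T.children i).length + 1),
        if (T.children i).drop p = [] then (if i = 0 then x else 1) else t)
        = (T.children i).length * t + (if i = 0 then x - 1 else 0) + 1 := by
      intro i
      rw [Finset.sum_range_succ, Finset.sum_congr rfl (g := fun _ => t)]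
      · simp only [Finset.sum_const, Finset.card_range, nsmul_eq_mul, List.drop_length, if_true]
        split_ifs <;> ring
      · intro p hp
        rw [if_neg]
        rw [List.drop_eq_nil_iff]
        exact (Finset.mem_range.1 hp).not_ge
    rw [← Finset.mul_sum, Finset.sum_sigma]
    simp only [hi, Finset.sum_add_distrib]
    rw [← Finset.sum_mul, ← Nat.cast_sum, hlen]
    simp
    ring
  simp only [h1]
  rw [Finset.sum_sigma']
  symm
  refine Finset.sum_bij (fun a _ => a.1.addLeaf a.2.1 ((a.1.children a.2.1).take a.2.2)
    ((a.1.children a.2.1).drop a.2.2) (List.take_append_drop _ _).symm) ?_ ?_ ?_ ?_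
  · intro a _
    simp [addLeaf_children_last]
  · rintro ⟨T₁, i₁, p₁⟩ h₁ ⟨T₂, i₂, p₂⟩ h₂ h
    obtain ⟨rfl, rfl, hl⟩ := addLeaf_injective h
    have hp := congrArg List.length hl
    simp only [Finset.mem_sigma, Finset.mem_univ, true_and, Finset.mem_range] at h₁ h₂
    simp only [List.length_take] at hp
    have : p₁ = p₂ := by omega
    rw [this]
  · intro S hS
    obtain ⟨T, i, l, r, h, rfl⟩ := S.exists_addLeaf_eq
      (List.length_eq_zero_iff.1 (Finset.mem_filter.1 hS).2)
    refine ⟨⟨T, i, l.length⟩, by simp [h], ?_⟩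
    congr 1 <;> simp [h]
  · intro a _
    rw [weight_addLeaf]

open Classical in
theorem sum_one_child :
    ∑ S : PlaneTree (Fin (n + 1)) with (S.children (Fin.last n)).length = 1, S.weight x t y
      = ∑ T : PlaneTree (Fin n), T.weight x t y * (n * y) := by
  have h1 : ∀ T : PlaneTree (Fin n), T.weight x t y * (n * y)
      = ∑ _i : Fin n, T.weight x t y * y := by
    intro T
    simp
    ring
  simp only [h1]
  rw [Finset.sum_sigma']
  symm
  refine Finset.sum_bij (fun a _ => a.1.insertAbove a.2) ?_ ?_ ?_ ?_
  · intro a _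
    simp [insertAbove, graft_children_last]
  · rintro ⟨T₁, i₁⟩ _ ⟨T₂, i₂⟩ _ h
    obtain rfl : i₁ = i₂ := by simpa using graft_new_eq h
    obtain rfl : T₁ = T₂ := graft_ext h (graft_kept_eq h)
    rfl
  · intro S hS
    obtain ⟨a', ha'⟩ := List.length_eq_one_iff.1 (Finset.mem_filter.1 hS).2
    obtain ⟨N, hN⟩ := exists_map_castSucc (S.notMem_children_self (Fin.last n))
    obtain ⟨a, rfl⟩ : ∃ a, N = [a] := by
      rw [ha'] at hN
      exact List.length_eq_one_iff.1 (by simpa using congrArg List.length hN)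
    obtain ⟨r, hr⟩ := S.exists_kept hN.symm List.mem_cons_self
    obtain ⟨T, hT, hTS⟩ := S.exists_graft_eq (cs := r) hN.symm hr.symm List.mem_cons_self
      (List.Perm.refl _)
    subst hT
    exact ⟨⟨T, a⟩, by simp, hTS⟩
  · intro a _
    rw [weight_insertAbove]

open Classical in
theorem sum_descent :
    ∑ S : PlaneTree (Fin (n + 1)) with
        2 ≤ (S.children (Fin.last n)).length ∧ S.EndsInDescent, S.weight x t y
      = ∑ T : PlaneTree (Fin n), T.weight x t y * (T.imp * t) := by
  have h1 : ∀ T : PlaneTree (Fin n), T.weight x t y * (T.imp * t)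
      = ∑ _e ∈ T.improperEdges, T.weight x t y * t := by
    intro T
    rw [Finset.sum_const, nsmul_eq_mul, improperEdges, imp]
    ring
  simp only [h1]
  rw [Finset.sum_sigma']
  symm
  have hmem : ∀ a : (_ : PlaneTree (Fin n)) × Fin n × Fin n,
      a ∈ Finset.univ.sigma improperEdges → a.2 ∈ a.1.improperEdges :=
    fun a ha => (Finset.mem_sigma.1 ha).2
  refine Finset.sum_bij (fun a ha => a.1.splitElder a.2.1 a.2.2
    (exists_split (hmem a ha)).choose (exists_split (hmem a ha)).choose_spec.choose
    (exists_split (hmem a ha)).choose_spec.choose_spec) ?_ ?_ ?_ ?_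
  · intro a ha
    rw [Finset.mem_filter]
    refine ⟨Finset.mem_univ _, ?_, (endsInDescent_splitElder _).2
      (mem_improperEdges.1 (hmem a ha))⟩
    rw [splitElder, graft_children_last]
    simp
  · rintro ⟨T₁, i₁, j₁⟩ _ ⟨T₂, i₂, j₂⟩ _ h
    obtain ⟨rfl, rfl, rfl⟩ := splitElder_injective h
    rfl
  · intro S hS
    obtain ⟨-, hlen, hdesc⟩ := Finset.mem_filter.1 hS
    obtain ⟨l, a, b, hN⟩ := S.exists_last_children hlen
    obtain ⟨r, hr⟩ := S.exists_kept hN (a := a) (by simp)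
    -- In a descent the penultimate child `a` plays the part of `i`, and the last child `b` that of
    -- `j`.
    obtain ⟨T, hT, hTS⟩ := S.exists_graft_eq (cs := l ++ b :: r) hN hr.symm (by simp)
      (by rw [List.append_assoc]; exact List.perm_middle)
    have hTS' : T.splitElder a b l r hT = S := hTS
    have he : (a, b) ∈ T.improperEdges :=
      mem_improperEdges.2 ((endsInDescent_splitElder hT).1 (hTS' ▸ hdesc))
    refine ⟨⟨T, a, b⟩, Finset.mem_sigma.2 ⟨Finset.mem_univ _, he⟩, ?_⟩
    obtain ⟨hl, hr⟩ := T.split_unique (exists_split he).choose_spec.choose_spec hT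
    rw [← hTS']
    congr 1
  · intro a ha
    rw [weight_splitElder _ _ _ _ _ (mem_improperEdges.1 (hmem a ha))]

open Classical in
theorem sum_ascent :
    ∑ S : PlaneTree (Fin (n + 1)) with
        2 ≤ (S.children (Fin.last n)).length ∧ ¬ S.EndsInDescent, S.weight x t y
      = ∑ T : PlaneTree (Fin n), T.weight x t y * (T.imp * y) := by
  have h1 : ∀ T : PlaneTree (Fin n), T.weight x t y * (T.imp * y)
      = ∑ _e ∈ T.improperEdges, T.weight x t y * y := by
    intro T
    rw [Finset.sum_const, nsmul_eq_mul, improperEdges, imp]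
    ring
  simp only [h1]
  rw [Finset.sum_sigma']
  symm
  have hmem : ∀ a : (_ : PlaneTree (Fin n)) × Fin n × Fin n,
      a ∈ Finset.univ.sigma improperEdges → a.2 ∈ a.1.improperEdges :=
    fun a ha => (Finset.mem_sigma.1 ha).2
  refine Finset.sum_bij (fun a ha => a.1.splitYounger a.2.1 a.2.2
    (exists_split (hmem a ha)).choose (exists_split (hmem a ha)).choose_spec.choose
    (exists_split (hmem a ha)).choose_spec.choose_spec) ?_ ?_ ?_ ?_
  · intro a ha
    rw [Finset.mem_filter]
    refine ⟨Finset.mem_univ _, ?_, (not_endsInDescent_splitYounger _).2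
      (mem_improperEdges.1 (hmem a ha))⟩
    rw [splitYounger, graft_children_last]
    simp
  · rintro ⟨T₁, i₁, j₁⟩ _ ⟨T₂, i₂, j₂⟩ _ h
    obtain ⟨rfl, rfl, rfl⟩ := splitYounger_injective h
    rfl
  · intro S hS
    obtain ⟨-, hlen, hasc⟩ := Finset.mem_filter.1 hS
    -- In an ascent the roles are exchanged: the last child `a` is the vertex merged with the
    -- largest one.
    obtain ⟨l, b, a, hN⟩ := S.exists_last_children hlen
    obtain ⟨r, hr⟩ := S.exists_kept hN (a := a) (by simp)
    obtain ⟨T, hT, hTS⟩ := S.exists_graft_eq (cs := l ++ b :: r) hN hr.symm (by simp)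
      (((List.Perm.swap a b []).append_left l).append_right r |>.trans
        (by rw [List.append_assoc]; exact List.perm_middle))
    have hTS' : T.splitYounger a b l r hT = S := hTS
    have he : (a, b) ∈ T.improperEdges :=
      mem_improperEdges.2 ((not_endsInDescent_splitYounger hT).1 (hTS' ▸ hasc))
    refine ⟨⟨T, a, b⟩, Finset.mem_sigma.2 ⟨Finset.mem_univ _, he⟩, ?_⟩
    obtain ⟨hl, hr⟩ := T.split_unique (exists_split he).choose_spec.choose_spec hT
    rw [← hTS']
    congr 1
  · intro a ha
    rw [weight_splitYounger _ _ _ _ _ (mem_improperEdges.1 (hmem a ha))]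

theorem sum_weight_succ :
    ∑ S : PlaneTree (Fin (n + 1)), S.weight x t y
      = ∑ T : PlaneTree (Fin n),
        T.weight x t y * (x + (n - 1) + (n - 1) * t + n * y + T.imp * (t + y)) := by
  classical
  have h : ∑ S : PlaneTree (Fin (n + 1)), S.weight x t y
      = ∑ S : PlaneTree (Fin (n + 1)) with (S.children (Fin.last n)).length = 0, S.weight x t y
      + ∑ S : PlaneTree (Fin (n + 1)) with (S.children (Fin.last n)).length = 1, S.weight x t y
      + ∑ S : PlaneTree (Fin (n + 1)) with
        2 ≤ (S.children (Fin.last n)).length ∧ S.EndsInDescent, S.weight x t y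
      + ∑ S : PlaneTree (Fin (n + 1)) with
        2 ≤ (S.children (Fin.last n)).length ∧ ¬ S.EndsInDescent, S.weight x t y := by
    simp only [Finset.sum_filter, ← Finset.sum_add_distrib]
    refine Finset.sum_congr rfl fun S _ => ?_
    rcases h : (S.children (Fin.last n)).length with _ | _ | k
    · simp
    · simp
    · by_cases hd : S.EndsInDescent <;> simp [hd]
  rw [h, sum_leaf, sum_one_child, sum_descent, sum_ascent, ← Finset.sum_add_distrib,
    ← Finset.sum_add_distrib, ← Finset.sum_add_distrib]
  exact Finset.sum_congr rfl fun T _ => by ring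

end Sums

end PlaneTree

/-! ### The polynomials satisfy the same recurrence -/

section ChapotonPolynomials

/-- Among the four substituted values only the one for y depends on the polynomial variable, and it
is that variable itself. -/
theorem aeval_pderiv_one (p : MvPolynomial (Fin 4) ℤ) :
    MvPolynomial.aeval ![Polynomial.C (MvPolynomial.X 0), Polynomial.X, 1,
        (Polynomial.C (MvPolynomial.X 1) : Polynomial (MvPolynomial (Fin 2) ℤ))]
        (MvPolynomial.pderiv 1 p)
      = Polynomial.derivative (MvPolynomial.aeval ![Polynomial.C (MvPolynomial.X 0), Polynomial.X,
          1, (Polynomial.C (MvPolynomial.X 1) : Polynomial (MvPolynomial (Fin 2) ℤ))] p) := by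
  induction p using MvPolynomial.induction_on with
  | C r => simp
  | add p q hp hq => simp [hp, hq]
  | mul_X p i hp =>
    rw [Derivation.leibniz, map_add, smul_eq_mul, smul_eq_mul, map_mul, map_mul, map_mul, hp,
      Polynomial.derivative_mul, MvPolynomial.aeval_X, MvPolynomial.pderiv_X]
    fin_cases i <;> simp <;> ring

theorem chapotonQY_one : chapotonQY 1 = 1 := by
  simp [chapotonQY, chapotonQ]

theorem chapotonQY_succ (n : ℕ) :
    chapotonQY (n + 2)
      = (Polynomial.C (MvPolynomial.X 0) + ((n + 1 : ℕ) : Polynomial (MvPolynomial (Fin 2) ℤ)))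
          * chapotonQY (n + 1)
        + (Polynomial.X + Polynomial.C (MvPolynomial.X 1))
          * (((n + 1 : ℕ) : Polynomial (MvPolynomial (Fin 2) ℤ)) * chapotonQY (n + 1)
            + Polynomial.X * Polynomial.derivative (chapotonQY (n + 1))) := by
  rw [chapotonQY, chapotonQ]
  simp only [map_add, map_mul, MvPolynomial.aeval_X, aeval_pderiv_one, map_natCast]
  rw [← chapotonQY]
  simp

/-- The substitution `x ↦ x - t - 1` in `ℤ[x, t]`. -/
noncomputable def shiftHom : MvPolynomial (Fin 2) ℤ →ₐ[ℤ] MvPolynomial (Fin 2) ℤ :=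
  MvPolynomial.aeval
    ![(MvPolynomial.X 0 - MvPolynomial.X 1 - 1 : MvPolynomial (Fin 2) ℤ), MvPolynomial.X 1]

theorem PlaneTree.children_fin_one (T : PlaneTree (Fin 1)) : T.children = fun _ => [] := by
  funext v
  rw [List.eq_nil_iff_forall_not_mem]
  intro j hj
  rw [Subsingleton.elim v j] at hj
  exact T.notMem_children_self j hj

theorem sum_weight_one {R : Type*} [CommRing R] (x t y : R) :
    ∑ T : PlaneTree (Fin 1), T.weight x t y = 1 := by
  let T₀ : PlaneTree (Fin 1) := PlaneTree.ofMultiset 0 (fun _ => []) (by simp)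
    fun v => by rw [Subsingleton.elim v 0]
  have huniq : ∀ T : PlaneTree (Fin 1), T = T₀ := fun T =>
    PlaneTree.ext (Subsingleton.elim _ _) (PlaneTree.children_fin_one T)
  have hw : T₀.weight x t y = 1 := by
    have hb : ∀ v, T₀.betaList v = [] := fun v => rfl
    rw [PlaneTree.weight, T₀.young_eq, T₀.eld_eq, T₀.imp_eq]
    simp [hb, youngerCount, elderCount, improperCount]
  rw [Finset.sum_eq_single T₀ (fun T _ h => absurd (huniq T) h) (by simp), hw]

theorem map_chapotonQY (n : ℕ) :
    (chapotonQY (n + 1)).map (shiftHom : MvPolynomial (Fin 2) ℤ →+* MvPolynomial (Fin 2) ℤ)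
      = ∑ T : PlaneTree (Fin (n + 1)), T.weight
          (Polynomial.C (MvPolynomial.X 0 : MvPolynomial (Fin 2) ℤ))
          (Polynomial.C (MvPolynomial.X 1)) Polynomial.X := by
  induction n with
  | zero => rw [chapotonQY_one, Polynomial.map_one, sum_weight_one]
  | succ n ih =>
    -- The Euler operator y∂_y reads off the exponent of y.
    have hy : ∀ T : PlaneTree (Fin (n + 1)),
        Polynomial.X * Polynomial.derivative (T.weight
          (Polynomial.C (MvPolynomial.X 0 : MvPolynomial (Fin 2) ℤ))
          (Polynomial.C (MvPolynomial.X 1)) Polynomial.X)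
        = T.weight (Polynomial.C (MvPolynomial.X 0 : MvPolynomial (Fin 2) ℤ))
          (Polynomial.C (MvPolynomial.X 1)) Polynomial.X
          * (T.imp : Polynomial (MvPolynomial (Fin 2) ℤ)) := by
      intro T
      rw [PlaneTree.weight, ← Polynomial.C_pow, ← Polynomial.C_pow, ← Polynomial.C_mul,
        Polynomial.derivative_C_mul, Polynomial.derivative_X_pow]
      -- The derivative of a power involves the truncated exponent `imp - 1`, so exponent zero is
      -- treated apart.
      rcases T.imp with _ | k
      · simp
      · simp only [Nat.add_sub_cancel, map_natCast]
        ring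
    have h0 : shiftHom (MvPolynomial.X 0) = MvPolynomial.X 0 - MvPolynomial.X 1 - 1 := by
      simp [shiftHom]
    have h1 : shiftHom (MvPolynomial.X 1) = MvPolynomial.X 1 := by simp [shiftHom]
    rw [chapotonQY_succ, PlaneTree.sum_weight_succ]
    simp only [Polynomial.map_add, Polynomial.map_mul, Polynomial.map_C, Polynomial.map_X,
      Polynomial.map_natCast, ← Polynomial.derivative_map, ih, RingHom.coe_coe,
      h0, h1]
    rw [Polynomial.derivative_sum, Finset.mul_sum Finset.univ _ Polynomial.X]
    simp only [hy]
    simp only [Finset.mul_sum, ← Finset.sum_add_distrib]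
    refine Finset.sum_congr rfl fun T _ => ?_
    simp only [map_sub, Polynomial.C_1]
    push_cast
    ring

end ChapotonPolynomials

/-- `Q_{n,k}(x - t - 1, t) = ∑_{T ∈ 𝒫_{n,k}} x ^ young_T(1) * t ^ eld(T)` in `ℤ[x, t]`, where
`X 0 = x`, `X 1 = t`, and the smallest label (the vertex `1` of `[n]`) is `0 : Fin n`. -/
theorem theorem2p2 (n : ℕ) (hn : 1 ≤ n) (k : ℕ) :
    MvPolynomial.aeval
        ![(MvPolynomial.X 0 - MvPolynomial.X 1 - 1 : MvPolynomial (Fin 2) ℤ), MvPolynomial.X 1]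
        (chapotonQCoeff n k)
      = ∑ T ∈ planeTrees n k,
          (MvPolynomial.X 0 : MvPolynomial (Fin 2) ℤ) ^ T.young ⟨0, hn⟩
            * (MvPolynomial.X 1 : MvPolynomial (Fin 2) ℤ) ^ T.eld := by
  obtain ⟨m, rfl⟩ := Nat.exists_eq_add_of_le' hn
  have h := congrArg (fun p => Polynomial.coeff p k) (map_chapotonQY m)
  simp only [Polynomial.coeff_map, Polynomial.finsetSum_coeff] at h
  refine h.trans ?_
  rw [planeTrees, Finset.sum_filter]
  refine Finset.sum_congr rfl fun T _ => ?_
  rw [PlaneTree.weight, ← Polynomial.C_pow, ← Polynomial.C_pow, ← Polynomial.C_mul,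
    Polynomial.coeff_C_mul, Polynomial.coeff_X_pow, mul_ite, mul_one, mul_zero]
  simp only [eq_comm (a := k)]
  rfl
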